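/- All graphs are finite and simple. For a graph $G$ let $L(G)=\operatorname{diag}(\deg)-A(G)$ be its Laplacian matrix, and for an $n\times n$ matrix $X=(x_{ij})$ let $\operatorname{per}X=\sum_{\sigma\in S_n}\prod_{t=1}^n x_{t\sigma(t)}$. For $1\le p\le q$ and $n=p+q$, let $\mathscr T_n^{p,q}$ be the set of (isomorphism classes of) trees whose vertex set is a disjoint union $V_1\cup V_2$ with $|V_1|=p$, $|V_2|=q$ such that every edge joins $V_1$ to $V_2$. For $p,q\ge 1$ the double star $D(p,q)$ is obtained from an edge $vw$ by attaching $p-1$ pendant vertices to $v$ and $q-1$ pendant vertices to $w$. For $p,q\ge 2$, $D'(p-1,q-1)$ (resp. $D''(p-1,q-1)$) is obtained from $D(p-1,q-1)$, in which $v$ has $p-2$ and $w$ has $q-2$ pendant neighbours, by attaching a pendant path of length $2$ to $w$ (resp. to $v$), i.e. by adding two new vertices $a,b$ and the edges $wa,ab$ (resp. $va,ab$). Finally, $T(n,k,a)$ is obtained from the path $P_k$ by attaching $a$ pendant vertices to one end-vertex and $n-k-a$ pendant vertices to the other. **Theorem 3.3.** (i) Let $p=2\le q$ and $n=q+2$.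 Then, up to isomorphism, $\mathscr T_n^{2,n-2}=\{T(n,3,i): 0\le i\le\lfloor (n-3)/2\rfloor\}$, and $$\operatorname{per}L(D(2,n-2))=\operatorname{per}L(T(n,3,0))<\operatorname{per}L(T(n,3,1))<\cdots<\operatorname{per}L\bigl(T(n,3,\lfloor\tfrac{n-3}{2}\rfloor)\bigr).$$ (ii) Let $2<p\le q$ and $n=p+q$. (a) $D(p,q)$ and $D'(p-1,q-1)$ belong to $\mathscr T_n^{p,q}$ and are not isomorphic, and $\operatorname{per}L(D(p,q))<(2p-3)(6q-5)+3$. For every $T\in\mathscr T_n^{p,q}$ with $T\not\cong D(p,q)$, $$\operatorname{per}L(T)\ge(2p-3)(6q-5)+3,$$ with equality if and only if $T\cong D'(p-1,q-1)$. (b) Suppose moreover that $q>p$. Then $D''(p-1,q-1)$ belongs to $\mathscr T_n^{p,q}$ and is isomorphic neither to $D(p,q)$ nor to $D'(p-1,q-1)$, and $(2p-3)(6q-5)+3<(2q-3)(6p-5)+3$. For every $T\in\mathscr T_n^{p,q}$ with $T\not\cong D(p,q)$ and $T\not\cong D'(p-1,q-1)$, $$\operatorname{per}L(T)\ge(2q-3)(6p-5)+3,$$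 with equality if and only if $T\cong D''(p-1,q-1)$. In particular, for $2<p\le q$ the second smallest value of $\operatorname{per}L$ on $\mathscr T_n^{p,q}$ is $(2p-3)(6q-5)+3$, attained only by $D'(p-1,q-1)$, and for $2<p<q$ the third smallest value is $(2q-3)(6p-5)+3$, attained only by $D''(p-1,q-1)$. -/

import Mathlib

universe u

/-- `G` with new pendant vertices: every `i : ι` becomes a new vertex, joined to `f i` only. -/
def attachPendants {V ι : Type*} (G : SimpleGraph V) (f : ι → V) : SimpleGraph (V ⊕ ι) where
  Adj x y :=
    match x, y with
    | Sum.inl u, Sum.inl v => G.Adj u v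
    | Sum.inl u, Sum.inr i => u = f i
    | Sum.inr i, Sum.inl u => u = f i
    | Sum.inr _, Sum.inr _ => False
  symm := ⟨by
    rintro (u | i) (v | j) h
    · exact G.adj_symm h
    · exact h
    · exact h
    · exact h⟩
  loopless := ⟨by
    rintro (u | i) h
    · exact G.loopless.irrefl u h
    · exact h⟩

/-- `G` with a pendant path of length 2 attached at the vertex `x`: the new edges are
`x a` and `a b`, where `a` and `b` are the two new vertices. -/
def attachPathTwo {V : Type*} (G : SimpleGraph V) (x : V) : SimpleGraph ((V ⊕ Unit) ⊕ Unit) :=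
  attachPendants (attachPendants G (fun _ : Unit => x)) (fun _ : Unit => Sum.inr ())

/-- The double star `D(p,q)`: `p - 1` pendant vertices are attached to the end `v = 0`, and
`q - 1` to the end `w = 1`, of an edge `v w`. -/
def doubleStar (p q : ℕ) : SimpleGraph (Fin 2 ⊕ (Fin (p - 1) ⊕ Fin (q - 1))) :=
  attachPendants (SimpleGraph.pathGraph 2) (Sum.elim (fun _ => 0) (fun _ => 1))

/-- `D'(a,b)`: the double star `D(a,b)` with a pendant path of length 2 attached to `w`. -/
def doubleStar' (a b : ℕ) :
    SimpleGraph (((Fin 2 ⊕ (Fin (a - 1) ⊕ Fin (b - 1))) ⊕ Unit) ⊕ Unit) :=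
  attachPathTwo (doubleStar a b) (Sum.inl 1)

/-- `D''(a,b)`: the double star `D(a,b)` with a pendant path of length 2 attached to `v`. -/
def doubleStar'' (a b : ℕ) :
    SimpleGraph (((Fin 2 ⊕ (Fin (a - 1) ⊕ Fin (b - 1))) ⊕ Unit) ⊕ Unit) :=
  attachPathTwo (doubleStar a b) (Sum.inl 0)

/-- `T(n,k,a)`: the path `P_k` with `a` pendant vertices attached to its first vertex and
`n - k - a` pendant vertices attached to its last vertex. -/
def pathWithPendants (n k a : ℕ) [NeZero k] :
    SimpleGraph (Fin k ⊕ (Fin a ⊕ Fin (n - k - a))) :=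
  attachPendants (SimpleGraph.pathGraph k) (Sum.elim (fun _ => 0) (fun _ => Fin.rev 0))

/-- `T` is a tree with a `(p,q)`-bipartition. -/
def IsBipartitionedTree {V : Type*} (T : SimpleGraph V) (p q : ℕ) : Prop :=
  T.IsTree ∧ ∃ V₁ V₂ : Set V, T.IsBipartiteWith V₁ V₂ ∧ V₁ ∪ V₂ = Set.univ ∧
    V₁.encard = p ∧ V₂.encard = q

open Classical in
/-- The Laplacian permanent `per L(G)`. -/
noncomputable def lapPer {V : Type*} [Fintype V] (G : SimpleGraph V) : ℤ :=
  (G.lapMatrix ℤ).permanent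

/-!
The permanent of the Laplacian of a tree is a sum over matchings: every permutation that
contributes is a product of disjoint transpositions along edges, and the signs cancel. Here this
is used in the form that, for a bipartite graph, the Laplacian and `diag(deg) + A` have the same
permanent (`lapPer_eq_weightedPermanent`), so that only matrices with nonnegative entries occur.

A pendant vertex of weight `1` can be absorbed by raising the weight of its neighbour by `1`
(`weightedPermanent_attachPendants`). Hence, if a tree `T` has the subtree `C` of non-leaves (its
core), and `k w` leaves hang at the core vertex `w`, then `lapPer T` is the permanent of
`diag(deg_C w + 2 k w) + A(C)` (`corePermanent`). Cores with two vertices give the double stars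
`D(p,q)`; cores with three vertices give the caterpillars `caterpillarThree a b c`, among which are
`T(n,3,i)`, `D'` and `D''`, and their permanents are explicit.

The main step (`IsCore.exists_smaller`) is a move that shrinks the core: if `l` is a leaf of the
core and `z` another core vertex of the same colour, moving all leaves at `l` to `z` preserves the
class sizes and strictly decreases the permanent. If the core has at least four vertices, of which
at least two have colour `b`, such moves lead to a core with three vertices, two of them of colour
`b`; by the explicit formula its permanent is at least `(2 q - 3) (6 p - 5) + 3`, where `p` is the
size of class `b` and `q` that of the other class. If the core has only one vertex of colour `b`,
the moves lead to a star with three edges, where the product of the diagonal entries is already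
larger than this value. So trees with at least four non-leaves exceed both critical values
(`IsCore.bound`), and it remains to compare the caterpillars: the permanent of
`caterpillarThree a b c` exceeds that of the extremal one with the same class sizes by
`8 (b + 1) (a - 1) (c - 1)`.
-/

/-! ### Permanents of matrices with nonnegative entries -/

section Permanent

open Matrix Finset

variable {α : Type*} [Fintype α] [DecidableEq α]

theorem permanent_reindex {β : Type*} [Fintype β] [DecidableEq β] (e : α ≃ β)
    (M : Matrix β β ℤ) : (M.submatrix e e).permanent = M.permanent := by
  unfold permanent
  refine Fintype.sum_equiv (Equiv.permCongr e) _ _ fun σ => ?_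
  exact Fintype.prod_equiv e _ _ fun i => by simp [Equiv.permCongr_apply]

theorem permanent_updateCol_add (M : Matrix α α ℤ) (j : α) (x y : α → ℤ) :
    (M.updateCol j (x + y)).permanent =
      (M.updateCol j x).permanent + (M.updateCol j y).permanent := by
  unfold permanent
  rw [← sum_add_distrib]
  refine sum_congr rfl fun σ _ => ?_
  rw [← mul_prod_erase _ _ (mem_univ j), ← mul_prod_erase _ _ (mem_univ j),
    ← mul_prod_erase _ _ (mem_univ j)]
  have h : ∀ z : α → ℤ, ∏ i ∈ univ.erase j, M.updateCol j z (σ i) i =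
      ∏ i ∈ univ.erase j, M (σ i) i := fun z =>
    prod_congr rfl fun i hi => by rw [updateCol_ne (ne_of_mem_erase hi)]
  rw [h, h, h]
  simp only [updateCol_self, Pi.add_apply, add_mul]

/-- The permanent of the principal submatrix of `M` without the row and the column of `u`, encoded
on the same index type by replacing the column of `u` by a unit vector. -/
def minorPermanent (M : Matrix α α ℤ) (u : α) : ℤ :=
  (M.updateCol u (Pi.single u 1)).permanent

theorem permanent_add_diagonal_single (M : Matrix α α ℤ) (u : α) (a : ℤ) :
    (M + diagonal (Pi.single u a)).permanent = M.permanent + a * minorPermanent M u := by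
  have h : M + diagonal (Pi.single u a) =
      M.updateCol u ((fun i => M i u) + a • (Pi.single u 1 : α → ℤ)) := by
    ext i j
    by_cases hj : j = u
    · subst hj
      by_cases hi : i = j
      · subst hi; simp
      · simp [hi]
    · by_cases hi : i = j
      · subst hi; simp [hj]
      · simp [hi, hj]
  rw [h, permanent_updateCol_add, permanent_updateCol_smul, minorPermanent]
  congr 2
  ext i j
  by_cases hj : j = u
  · subst hj; simp
  · simp [hj]

theorem permanent_mono {M N : Matrix α α ℤ} (h₀ : ∀ i j, 0 ≤ M i j) (h : ∀ i j, M i j ≤ N i j) :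
    M.permanent ≤ N.permanent :=
  sum_le_sum fun _ _ => prod_le_prod (fun _ _ => h₀ _ _) fun _ _ => h _ _

theorem permanent_nonneg {M : Matrix α α ℤ} (h₀ : ∀ i j, 0 ≤ M i j) : 0 ≤ M.permanent :=
  sum_nonneg fun _ _ => prod_nonneg fun _ _ => h₀ _ _

theorem prod_diag_le_permanent {M : Matrix α α ℤ} (h₀ : ∀ i j, 0 ≤ M i j) :
    ∏ i, M i i ≤ M.permanent :=
  single_le_sum (f := fun σ : Equiv.Perm α => ∏ i, M (σ i) i)
    (fun _ _ => prod_nonneg fun _ _ => h₀ _ _) (mem_univ 1)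

/-- The permutations fixing `u` contribute at most the whole permanent. -/
theorem mul_minorPermanent_le {M : Matrix α α ℤ} (h₀ : ∀ i j, 0 ≤ M i j) (u : α) :
    M u u * minorPermanent M u ≤ M.permanent := by
  rw [minorPermanent, ← permanent_updateCol_smul]
  refine permanent_mono (fun i j => ?_) fun i j => ?_
  all_goals
    by_cases hj : j = u
    · subst hj
      by_cases hi : i = j
      · subst hi; simp [h₀]
      · simp [hi, h₀]
    · simp [hj, h₀]

/-- Expansion of the permanent along a pendant vertex `none` attached to `u`. -/
theorem permanent_option (M : Matrix (Option α) (Option α) ℤ) (u : α)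
    (hrow : ∀ v, M none (some v) = if v = u then 1 else 0)
    (hcol : ∀ v, M (some v) none = if v = u then 1 else 0) :
    M.permanent = M none none * (M.submatrix some some).permanent +
      minorPermanent (M.submatrix some some) u := by
  have key : ∀ (i : Option α) (τ : Equiv.Perm α),
      ∏ o, M (Equiv.Perm.decomposeOption.symm (i, τ) o) o =
        M i none * ∏ v, M (Equiv.swap none i (some (τ v))) (some v) := by
    intro i τ
    rw [Fintype.prod_option]
    simp [Equiv.Perm.decomposeOption]
  rw [permanent, ← Equiv.sum_comp Equiv.Perm.decomposeOption.symm, Fintype.sum_prod_type,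
    Fintype.sum_option]
  simp only [key]
  congr 1
  · simp [permanent, mul_sum]
  · rw [sum_eq_single u]
    · rw [minorPermanent, permanent]
      refine sum_congr rfl fun τ _ => ?_
      rw [hcol, if_pos rfl, one_mul]
      by_cases hτ : τ u = u
      · refine prod_congr rfl fun v _ => ?_
        by_cases hv : v = u
        · subst hv; simp [hτ, hrow]
        · have : τ v ≠ u := fun h => hv (τ.injective (h.trans hτ.symm))
          rw [updateCol_ne hv, Equiv.swap_apply_of_ne_of_ne (by simp) (by simpa using this)]
          rfl
      · rw [prod_eq_zero (mem_univ (τ.symm u)), prod_eq_zero (mem_univ u)]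
        · simp [hτ]
        · have : τ.symm u ≠ u := fun h => hτ ((Equiv.symm_apply_eq τ).1 h).symm
          simp [hrow, this]
    · intro j _ hj
      simp [hcol, hj]
    · simp

end Permanent

/-! ### Attaching pendant vertices -/

section Pendants

open Finset

variable {V W ι κ : Type*}

@[simp] theorem attachPendants_adj_inl_inl (G : SimpleGraph V) (f : ι → V) (u v : V) :
    (attachPendants G f).Adj (Sum.inl u) (Sum.inl v) ↔ G.Adj u v := Iff.rfl

@[simp] theorem attachPendants_adj_inl_inr (G : SimpleGraph V) (f : ι → V) (u : V) (i : ι) :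
    (attachPendants G f).Adj (Sum.inl u) (Sum.inr i) ↔ u = f i := Iff.rfl

@[simp] theorem attachPendants_adj_inr_inl (G : SimpleGraph V) (f : ι → V) (u : V) (i : ι) :
    (attachPendants G f).Adj (Sum.inr i) (Sum.inl u) ↔ u = f i := Iff.rfl

@[simp] theorem attachPendants_adj_inr_inr (G : SimpleGraph V) (f : ι → V) (i j : ι) :
    ¬ (attachPendants G f).Adj (Sum.inr i) (Sum.inr j) := id

/-- Isomorphic graphs with correspondingly attached pendant vertices are isomorphic. -/
def attachPendantsIso {G : SimpleGraph V} {H : SimpleGraph W} {f : ι → V} {g : κ → W}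
    (e : G ≃g H) (e' : ι ≃ κ) (h : ∀ i, g (e' i) = e (f i)) :
    attachPendants G f ≃g attachPendants H g where
  toEquiv := Equiv.sumCongr e.toEquiv e'
  map_rel_iff' := by
    rintro (u | i) (v | j)
    · simp [e.map_adj_iff]
    · simp [h]
    · simp [h]
    · simp

/-- Pendant vertices can be attached one at a time. -/
def attachPendantsOptionIso (G : SimpleGraph V) (f : Option ι → V) :
    attachPendants G f ≃g
      attachPendants (attachPendants G (f ∘ some)) (fun _ : Unit => Sum.inl (f none)) where
  toFun := Sum.elim (Sum.inl ∘ Sum.inl)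
    fun o => o.elim (Sum.inr ()) fun i => Sum.inl (Sum.inr i)
  invFun := Sum.elim (Sum.elim Sum.inl (Sum.inr ∘ some)) fun _ => Sum.inr none
  left_inv := by rintro (v | _ | i) <;> rfl
  right_inv := by rintro ((v | i) | _) <;> rfl
  map_rel_iff' := by
    rintro (u | _ | i) (v | _ | j) <;> simp

/-- When pendant vertices are attached by `f` and by `g` to vertices of `G`, and then by `h` to the
new vertices of the family `g`, the family `f` can be attached last. -/
def attachPendantsCommIso {μ : Type*} (G : SimpleGraph V) (f : ι → V) (g : κ → V) (h : μ → κ) :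
    attachPendants (attachPendants (attachPendants G f) (fun k => Sum.inl (g k)))
        (fun m => Sum.inr (h m)) ≃g
      attachPendants (attachPendants G g)
        (Sum.elim (fun i => Sum.inl (f i)) (fun m => Sum.inr (h m))) where
  toFun := Sum.elim (Sum.elim (Sum.elim (Sum.inl ∘ Sum.inl) (Sum.inr ∘ Sum.inl))
    (Sum.inl ∘ Sum.inr)) (Sum.inr ∘ Sum.inr)
  invFun := Sum.elim (Sum.elim (Sum.inl ∘ Sum.inl ∘ Sum.inl) (Sum.inl ∘ Sum.inr))
    (Sum.elim (Sum.inl ∘ Sum.inl ∘ Sum.inr) Sum.inr)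
  left_inv := by rintro (((v | i) | k) | m) <;> rfl
  right_inv := by rintro ((v | k) | (i | m)) <;> rfl
  map_rel_iff' := by
    rintro (((v | i) | k) | m) (((v' | i') | k') | m') <;> simp

open scoped Classical in
/-- The number of new vertices that `attachPendants` attaches to `v` by `f`. -/
noncomputable def pendantCount [Fintype ι] (f : ι → V) (v : V) : ℕ := #{i | f i = v}

theorem pendantCount_congr [Fintype ι] [Fintype κ] (f : ι → V) (g : κ → V) (e : ι ≃ κ)
    (h : ∀ i, g (e i) = f i) (v : V) : pendantCount f v = pendantCount g v := by
  classical
  unfold pendantCount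
  refine card_bij (fun i _ => e i) (by simp [h]) (by simp) fun b hb => ⟨e.symm b, ?_, by simp⟩
  have := h (e.symm b)
  simp_all

theorem exists_equiv_of_pendantCount [Fintype ι] [Fintype κ] {f : ι → V} {g : κ → W} (e : V ≃ W)
    (h : ∀ v, pendantCount g (e v) = pendantCount f v) :
    ∃ e' : ι ≃ κ, ∀ i, g (e' i) = e (f i) := by
  classical
  have hc : ∀ v, Nonempty ({i // f i = v} ≃ {k // g k = e v}) := fun v =>
    ⟨Fintype.equivOfCardEq (by
      rw [Fintype.card_subtype, Fintype.card_subtype]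
      have := h v
      unfold pendantCount at this
      convert this.symm)⟩
  have E := fun v => (hc v).some
  refine ⟨(Equiv.sigmaFiberEquiv f).symm.trans ((Equiv.sigmaCongr e E).trans
    (Equiv.sigmaFiberEquiv g)), fun i => ?_⟩
  simp only [Equiv.trans_apply]
  exact (E (f i) ⟨i, rfl⟩).2

/-- The isomorphism type of `attachPendants G f` depends only on how many vertices are attached
to each vertex of `G`. -/
theorem nonempty_attachPendants_iso [Fintype ι] [Fintype κ] {G : SimpleGraph V}
    {H : SimpleGraph W} {f : ι → V} {g : κ → W} (e : G ≃g H)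
    (h : ∀ v, pendantCount g (e v) = pendantCount f v) :
    Nonempty (attachPendants G f ≃g attachPendants H g) := by
  obtain ⟨e', he'⟩ := exists_equiv_of_pendantCount e.toEquiv h
  exact ⟨attachPendantsIso e e' he'⟩

theorem pendantCount_elim [Fintype ι] [Fintype κ] (f : ι → V) (g : κ → V) (v : V) :
    pendantCount (Sum.elim f g) v = pendantCount f v + pendantCount g v := by
  classical
  unfold pendantCount
  simp only [card_filter, Fintype.sum_sum_type, Sum.elim_inl, Sum.elim_inr]
  rfl

open scoped Classical in
theorem pendantCount_const [Fintype ι] (u v : V) :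
    pendantCount (fun _ : ι => u) v = if u = v then Fintype.card ι else 0 := by
  unfold pendantCount
  split_ifs with h <;> simp [h]

open scoped Classical in
theorem pendantCount_option [Fintype ι] (f : Option ι → V) (v : V) :
    pendantCount f v = (if f none = v then 1 else 0) + pendantCount (f ∘ some) v := by
  unfold pendantCount
  simp only [card_filter, Fintype.sum_option, Function.comp]

theorem pendantCount_comp_injective [Fintype ι] (f : ι → V) {g : V → W}
    (hg : Function.Injective g) (v : V) : pendantCount (g ∘ f) (g v) = pendantCount f v := by
  classical
  unfold pendantCount
  simp [hg.eq_iff]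

theorem pendantCount_comp_of_notMem [Fintype ι] (f : ι → V) {g : V → W}
    {w : W} (hw : ∀ v, g v ≠ w) : pendantCount (g ∘ f) w = 0 := by
  classical
  unfold pendantCount
  simp [hw]

section Degree

open scoped Classical

variable [Fintype V] [Fintype ι]

theorem degree_eq_sum (G : SimpleGraph V) (v : V) :
    G.degree v = ∑ w, if G.Adj v w then 1 else 0 := by
  rw [← SimpleGraph.card_neighborFinset_eq_degree, SimpleGraph.neighborFinset_eq_filter,
    card_filter]

theorem degree_attachPendants_inl (G : SimpleGraph V) (f : ι → V) (v : V) :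
    (attachPendants G f).degree (Sum.inl v) = G.degree v + pendantCount f v := by
  rw [degree_eq_sum, degree_eq_sum, Fintype.sum_sum_type, pendantCount, card_filter]
  simp only [attachPendants_adj_inl_inl, attachPendants_adj_inl_inr, eq_comm (a := v)]

theorem degree_attachPendants_inr (G : SimpleGraph V) (f : ι → V) (i : ι) :
    (attachPendants G f).degree (Sum.inr i) = 1 := by
  rw [degree_eq_sum, Fintype.sum_sum_type]
  simp

theorem isTree_attachPendants {G : SimpleGraph V} (hG : G.IsTree) (f : ι → V) :
    (attachPendants G f).IsTree := by
  have hconn : (attachPendants G f).Connected := by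
    have hl : ∀ u v, (attachPendants G f).Reachable (Sum.inl u) (Sum.inl v) := fun u v =>
      (hG.connected.preconnected u v).map
        (⟨Sum.inl, fun h => h⟩ : G →g attachPendants G f)
    have hr : ∀ i, (attachPendants G f).Reachable (Sum.inr i) (Sum.inl (f i)) := fun i =>
      SimpleGraph.Adj.reachable (by simp)
    have := hG.connected.nonempty
    refine ⟨?_⟩
    rintro (u | i) (v | j)
    · exact hl u v
    · exact (hl u (f j)).trans (hr j).symm
    · exact (hr i).trans (hl (f i) v)
    · exact (hr i).trans ((hl _ _).trans (hr j).symm)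
  rw [SimpleGraph.isTree_iff_connected_and_card]
  refine ⟨hconn, ?_⟩
  have h1 := hG.card_edgeFinset
  have h2 := G.sum_degrees_eq_twice_card_edges
  have h3 := (attachPendants G f).sum_degrees_eq_twice_card_edges
  have h4 : ∑ v, pendantCount f v = Fintype.card ι := by
    simp only [pendantCount]
    rw [← card_univ, card_eq_sum_card_fiberwise (f := f) (t := univ) (by simp)]
  simp only [Fintype.sum_sum_type, degree_attachPendants_inl, degree_attachPendants_inr,
    sum_add_distrib, h4] at h3
  simp only [sum_const, card_univ, smul_eq_mul, mul_one] at h3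
  rw [Nat.card_eq_fintype_card, ← SimpleGraph.edgeFinset_card, Nat.card_eq_fintype_card,
    Fintype.card_sum]
  omega

end Degree

end Pendants

/-! ### Weighted permanents of graphs -/

section WeightedPermanent

open Finset Matrix
open scoped Classical

variable {V W ι : Type*} [Fintype V] [Fintype W] [Fintype ι]

/-- The permanent of `diag(x) + A(G)`. For a forest this is the sum over all matchings of the
products of the weights `x v` of the unmatched vertices `v`. -/
noncomputable def weightedPermanent (G : SimpleGraph V) (x : V → ℤ) : ℤ :=
  (diagonal x + G.adjMatrix ℤ).permanent

/-- The definition in terms of arbitrary decidability instances. -/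
theorem weightedPermanent_eq [DecidableEq V] (G : SimpleGraph V) [DecidableRel G.Adj]
    (x : V → ℤ) : weightedPermanent G x = (diagonal x + G.adjMatrix ℤ).permanent := by
  unfold weightedPermanent
  congr!

theorem weightedPermanent_congr {G : SimpleGraph V} {H : SimpleGraph W} (e : G ≃g H) {x : V → ℤ}
    {y : W → ℤ} (h : ∀ v, y (e v) = x v) : weightedPermanent G x = weightedPermanent H y := by
  unfold weightedPermanent
  rw [← permanent_reindex e.toEquiv]
  congr 1
  ext u v
  simp [diagonal_apply, SimpleGraph.adjMatrix_apply, e.map_adj_iff, h]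

theorem lapPer_congr {G : SimpleGraph V} {H : SimpleGraph W} (e : G ≃g H) :
    lapPer G = lapPer H := by
  unfold lapPer
  rw [← permanent_reindex e.toEquiv]
  congr 1
  ext u v
  have hd : H.degree (e u) = G.degree u := e.degree_eq u
  simp [SimpleGraph.lapMatrix, SimpleGraph.degMatrix, diagonal_apply, SimpleGraph.adjMatrix_apply,
    e.map_adj_iff, hd]

/-- In a bipartite graph the signs of the off-diagonal entries of the Laplacian do not affect its
permanent: conjugate by the diagonal matrix with entries `1` and `-1` on the two classes. -/
theorem lapPer_eq_weightedPermanent (G : SimpleGraph V) (c : V → Bool)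
    (hc : ∀ u v, G.Adj u v → c u ≠ c v) :
    lapPer G = weightedPermanent G (fun v => (G.degree v : ℤ)) := by
  unfold lapPer weightedPermanent permanent
  let s : V → ℤ := fun v => if c v then 1 else -1
  have hs : ∀ v, s v * s v = 1 := fun v => by simp only [s]; split_ifs <;> rfl
  refine sum_congr rfl fun σ _ => ?_
  have h : ∀ u v, (G.lapMatrix ℤ) u v =
      s u * (diagonal (fun v => (G.degree v : ℤ)) + G.adjMatrix ℤ) u v * s v := by
    intro u v
    by_cases huv : u = v
    · subst huv
      have := hs u
      simp only [SimpleGraph.lapMatrix, SimpleGraph.degMatrix, Matrix.sub_apply,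
        Matrix.add_apply,        diagonal_apply_eq, SimpleGraph.adjMatrix_apply, SimpleGraph.irrefl, if_false]
      linear_combination -(G.degree u : ℤ) * this
    · by_cases ha : G.Adj u v
      · have := hc u v ha
        have h1 : s u * s v = -1 := by
          simp only [s]
          cases hu : c u <;> cases hv : c v <;> simp_all
        simp [SimpleGraph.lapMatrix, SimpleGraph.degMatrix, huv, ha, h1]
      · simp [SimpleGraph.lapMatrix, SimpleGraph.degMatrix, huv, ha]
  simp only [h, prod_mul_distrib]
  have h2 : ∏ i, s (σ i) = ∏ i, s i := Equiv.prod_comp σ s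
  have h3 : (∏ i, s i) * ∏ i, s i = 1 := by rw [← prod_mul_distrib]; simp [hs]
  rw [h2]
  linear_combination (∏ i, (diagonal (fun v => (G.degree v : ℤ)) + G.adjMatrix ℤ) (σ i) i) * h3

/-- Expansion of the weighted permanent along one pendant vertex of weight `a`. -/
theorem weightedPermanent_attachPendants_unit [DecidableEq V] (G : SimpleGraph V) (u : V) (x : V ⊕ Unit → ℤ) :
    weightedPermanent (attachPendants G (fun _ : Unit => u)) x =
      x (Sum.inr ()) * weightedPermanent G (x ∘ Sum.inl) +
        minorPermanent (diagonal (x ∘ Sum.inl) + G.adjMatrix ℤ) u := by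
  rw [weightedPermanent_eq, weightedPermanent_eq, ← permanent_reindex (Equiv.optionEquivSumPUnit.{0} V), permanent_option _ u]
  · congr 2
    · simp [SimpleGraph.adjMatrix_apply]
    · congr 1
      ext i j
      simp [diagonal_apply, SimpleGraph.adjMatrix_apply]
    · ext i j
      simp [diagonal_apply, SimpleGraph.adjMatrix_apply]
  · intro v
    simp [SimpleGraph.adjMatrix_apply]
  · intro v
    simp [SimpleGraph.adjMatrix_apply]

theorem weightedPermanent_add_single [DecidableEq V] (G : SimpleGraph V) (u : V) (x : V → ℤ) (a : ℤ) :
    weightedPermanent G (x + Pi.single u a) = weightedPermanent G x +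
      a * minorPermanent (diagonal x + G.adjMatrix ℤ) u := by
  rw [weightedPermanent_eq, weightedPermanent_eq, ← permanent_add_diagonal_single,
    add_right_comm, diagonal_add]
  rfl

/-- A pendant vertex of weight `1` can be removed when the weight of its neighbour is increased
by `1`. -/
theorem weightedPermanent_attachPendants (G : SimpleGraph V) (f : ι → V) (x : V → ℤ) :
    weightedPermanent (attachPendants G f) (Sum.elim x fun _ => 1) =
      weightedPermanent G (fun v => x v + pendantCount f v) := by
  revert f x
  refine Fintype.induction_empty_option
    (P := fun ι [Fintype ι] => ∀ (f : ι → V) (x : V → ℤ),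
      weightedPermanent (attachPendants G f) (Sum.elim x fun _ => 1) =
        weightedPermanent G (fun v => x v + pendantCount f v)) ?_ ?_ ?_ ι
  · intro κ μ _ e ih f x
    let _ := Fintype.ofEquiv μ e.symm
    have h1 := ih (f ∘ e) x
    have h2 : ∀ v, pendantCount (f ∘ e) v = pendantCount f v :=
      pendantCount_congr _ _ e fun _ => rfl
    simp only [h2] at h1
    rw [← h1]
    refine (weightedPermanent_congr
      (attachPendantsIso (SimpleGraph.Iso.refl (G := G)) e fun i => rfl) ?_).symm
    rintro (v | i) <;> rfl
  · intro f x
    refine weightedPermanent_congr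
      ⟨Equiv.sumEmpty V PEmpty, fun {a b} => ?_⟩ fun v => ?_
    · rcases a with a | ⟨⟨⟩⟩
      rcases b with b | ⟨⟨⟩⟩
      simp
    · rcases v with v | ⟨⟨⟩⟩
      simp [pendantCount]
  · intro κ _ ih f x
    rw [weightedPermanent_congr (attachPendantsOptionIso G f)
      (y := Sum.elim (Sum.elim x fun _ => 1) fun _ => 1)
      (by rintro (v | _ | i) <;> rfl), weightedPermanent_attachPendants_unit]
    have h := weightedPermanent_add_single (attachPendants G (f ∘ some)) (Sum.inl (f none))
      (Sum.elim x fun _ => 1) 1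
    simp only [Sum.elim_inr, one_mul, Sum.elim_comp_inl] at h ⊢
    rw [← h]
    have h2 : (Sum.elim x fun _ => 1) + Pi.single (Sum.inl (f none)) 1 =
        (Sum.elim (x + Pi.single (f none) 1) fun _ : κ => (1 : ℤ)) := by
      ext (v | i)
      · simp [Pi.single_apply]
      · simp
    rw [h2, ih]
    congr 1
    ext v
    rw [pendantCount_option, Pi.add_apply, Pi.single_apply]
    simp only [eq_comm (a := v)]
    push_cast
    ring

/-- The Laplacian permanent of a bipartite graph with attached pendant vertices, in terms of the
original graph: each pendant vertex at `v` counts once in the degree of `v` and once when absorbed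
as a vertex of weight `1`. -/
theorem lapPer_attachPendants (G : SimpleGraph V) (f : ι → V) (c : V → Bool)
    (hc : ∀ u v, G.Adj u v → c u ≠ c v) :
    lapPer (attachPendants G f) =
      weightedPermanent G (fun v => (G.degree v : ℤ) + 2 * pendantCount f v) := by
  rw [lapPer_eq_weightedPermanent _ (Sum.elim c fun i => !c (f i))]
  · have h : (fun v => ((attachPendants G f).degree v : ℤ)) =
        Sum.elim (fun v => (G.degree v : ℤ) + pendantCount f v) fun _ => 1 := by
      ext (v | i)
      · simp [degree_attachPendants_inl]
      · simp [degree_attachPendants_inr]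
    rw [h, weightedPermanent_attachPendants]
    congr 1
    ext v
    ring
  · rintro (u | i) (v | j) h
    · exact hc u v h
    · obtain rfl : u = f j := h
      simp
    · obtain rfl : v = f i := h
      simp
    · exact h.elim

end WeightedPermanent

/-! ### The core of a tree -/

section Trees

open Finset
open scoped Classical

universe v

variable {V W ι : Type*}

/-- In a connected graph with at least three vertices, the neighbour of a leaf `u` has another
neighbour; in particular two leaves are not adjacent. -/
theorem exists_adj_ne_of_forall_adj_eq [Fintype V] {T : SimpleGraph V} (hT : T.Connected)
    (hV : 3 ≤ Fintype.card V) {u v : V} (hu : ∀ w, T.Adj u w → w = v) :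
    ∃ w, T.Adj v w ∧ w ≠ u := by
  by_contra! hv
  have hwalk : ∀ {x y : V}, T.Walk x y → x = u ∨ x = v → y = u ∨ y = v := by
    intro x y p
    induction p with
    | nil => exact id
    | cons h p ih =>
      rintro (rfl | rfl)
      · exact ih (Or.inr (hu _ h))
      · exact ih (Or.inl (hv _ h))
  have hsub : (univ : Finset V) ⊆ {u, v} := fun y _ => by
    obtain ⟨p⟩ := hT.preconnected u y
    simpa using hwalk p (Or.inl rfl)
  have := (card_le_card hsub).trans card_le_two
  rw [card_univ] at this
  omega

/-- Splitting off pendant vertices: if every vertex outside `S` has exactly one neighbour, and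
this neighbour is in `S`, then `T` arises from the subgraph induced on `S` by attaching pendant
vertices. -/
theorem exists_iso_attachPendants_induce {T : SimpleGraph V} (hT : T.IsTree) (S : Set V)
    (hS : ∀ v ∉ S, ∃ u ∈ S, ∀ w, T.Adj v w ↔ w = u) :
    (T.induce S).IsTree ∧ ∃ (f : {v // v ∉ S} → S) (e : T ≃g attachPendants (T.induce S) f),
      ∀ w : S, e.symm (Sum.inl w) = w := by
  have hne : Nonempty S := by
    obtain ⟨v⟩ := hT.connected.nonempty
    by_cases hv : v ∈ S
    · exact ⟨v, hv⟩
    · obtain ⟨u, hu, -⟩ := hS v hv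
      exact ⟨u, hu⟩
  refine ⟨⟨⟨hT.connected.preconnected.induce_of_degree_eq_one fun v hv => ?_⟩,
    hT.isAcyclic.induce S⟩, ?_⟩
  · obtain ⟨u, -, hu⟩ := hS v hv
    exact fun a ha b hb => ((hu a).1 ha).trans ((hu b).1 hb).symm
  choose g hgS hg using fun v : {v // v ∉ S} => hS v v.2
  refine ⟨fun v => ⟨g v, hgS v⟩, SimpleGraph.Iso.symm ⟨Equiv.sumCompl (· ∈ S), ?_⟩, fun w => rfl⟩
  rintro (a | a) (b | b)
  · simp
  · simp only [Equiv.sumCompl_apply_inl, Equiv.sumCompl_apply_inr, attachPendants_adj_inl_inr]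
    rw [SimpleGraph.adj_comm, hg, Subtype.ext_iff]
  · simp only [Equiv.sumCompl_apply_inl, Equiv.sumCompl_apply_inr, attachPendants_adj_inr_inl]
    rw [hg, Subtype.ext_iff]
  · simp only [Equiv.sumCompl_apply_inr, attachPendants_adj_inr_inr, iff_false]
    rw [hg]
    intro h
    exact b.2 (h ▸ hgS a)

theorem exists_forall_adj_iff_of_degree_eq_one [Fintype V] {T : SimpleGraph V} {v : V}
    (h : T.degree v = 1) : ∃ u, ∀ w, T.Adj v w ↔ w = u := by
  obtain ⟨u, hu, huniq⟩ := SimpleGraph.degree_eq_one_iff_existsUnique_adj.1 h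
  exact ⟨u, fun w => ⟨huniq w, fun hw => hw ▸ hu⟩⟩

/-- Every tree with at least three vertices arises from a smaller tree `C`, the subtree of its
non-leaves, by attaching pendant vertices; every leaf of `C` receives at least one of them. -/
theorem exists_core {V : Type v} [Fintype V] {T : SimpleGraph V} (hT : T.IsTree)
    (hV : 3 ≤ Fintype.card V) :
    ∃ (W : Type v) (_ : Fintype W) (C : SimpleGraph W) (ι : Type v) (_ : Fintype ι) (f : ι → W),
      C.IsTree ∧ (∀ w, C.degree w = 1 → 1 ≤ pendantCount f w) ∧
        Nonempty (T ≃g attachPendants C f) := by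
  let S : Set V := {v | T.degree v ≠ 1}
  obtain ⟨h1, f, e, he⟩ := exists_iso_attachPendants_induce hT S fun v hv => by
    have hv : T.degree v = 1 := not_not.1 hv
    obtain ⟨u, hu⟩ := exists_forall_adj_iff_of_degree_eq_one hv
    refine ⟨u, fun h => ?_, hu⟩
    obtain ⟨w, hw, hwv⟩ := exists_adj_ne_of_forall_adj_eq hT.connected hV fun w => (hu w).1
    obtain ⟨x, hx⟩ := exists_forall_adj_iff_of_degree_eq_one h
    exact hwv (((hx w).1 hw).trans ((hx v).1 ((hu u).2 rfl).symm).symm)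
  refine ⟨S, inferInstance, T.induce S, {v // v ∉ S}, inferInstance, f, h1, fun w hw => ?_, ⟨e⟩⟩
  by_contra! h0
  have hd := degree_attachPendants_inl (T.induce S) f w
  have he' := e.symm.degree_eq (Sum.inl w)
  rw [he w] at he'
  apply w.2
  rw [← he'] at hd
  omega

/-- Every edge of a tree has exactly one end of colour `b`. -/
theorem sum_degree_color [Fintype V] {T : SimpleGraph V} (hT : T.IsTree) (c : V → Bool)
    (hc : ∀ u v, T.Adj u v → c u ≠ c v) (b : Bool) :
    (∑ v with c v = b, T.degree v) + 1 = Fintype.card V := by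
  have h : T.IsBipartiteWith (univ.filter (c · = b) : Finset V)
      (univ.filter (c · ≠ b) : Finset V) := by
    refine ⟨?_, fun v w hvw => ?_⟩
    · rw [disjoint_coe]
      exact disjoint_filter_filter_not _ _ _
    · have := hc v w hvw
      simp only [coe_filter, Set.mem_ofPred_eq, mem_univ, true_and]
      cases hv : c v <;> cases hw : c w <;> cases b <;> simp_all
  have h2 := SimpleGraph.isBipartiteWith_sum_degrees_eq_card_edges h
  have h3 := hT.card_edgeFinset
  rw [← h3, ← h2]

/-- Around a leaf `l` of a tree with at least three vertices there is a path `l, u, z`. -/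
theorem exists_path_of_degree_eq_one [Fintype V] {T : SimpleGraph V} (hT : T.Connected)
    (hV : 3 ≤ Fintype.card V) {l : V} (hl : T.degree l = 1) :
    ∃ u z, (∀ w, T.Adj l w ↔ w = u) ∧ T.Adj u z ∧ z ≠ l := by
  obtain ⟨u, hu⟩ := exists_forall_adj_iff_of_degree_eq_one hl
  obtain ⟨z, hz, hzl⟩ := exists_adj_ne_of_forall_adj_eq hT hV fun w => (hu w).1
  exact ⟨u, z, hu, hz, hzl⟩

theorem nonempty_iso_pathGraph_three [Fintype V] {T : SimpleGraph V} (hT : T.IsTree)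
    (hV : Fintype.card V = 3) (c : V → Bool) (hc : ∀ u v, T.Adj u v → c u ≠ c v) :
    Nonempty (SimpleGraph.pathGraph 3 ≃g T) := by
  have : Nontrivial V := Fintype.one_lt_card_iff_nontrivial.1 (by omega)
  obtain ⟨l, hl⟩ := hT.exists_vert_degree_one_of_nontrivial
  obtain ⟨u, z, hlu, huz, hzl⟩ := exists_path_of_degree_eq_one hT.connected hV.ge hl
  have hlu := (hlu u).2 rfl
  have hlz : ¬ T.Adj l z := fun h => by
    have h1 := hc _ _ h
    have h2 := hc _ _ huz
    have h3 := hc _ _ hlu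
    cases hl : c l <;> cases hu : c u <;> cases hz : c z <;> simp_all
  have hinj : Function.Injective ![l, u, z] := by
    intro i j
    fin_cases i <;> fin_cases j <;>
      simp [hlu.ne, hlu.ne', huz.ne, huz.ne', hzl, hzl.symm]
  refine ⟨⟨Equiv.ofBijective _ ((Fintype.bijective_iff_injective_and_card _).2
    ⟨hinj, by simp [hV]⟩), fun {i j} => ?_⟩⟩
  fin_cases i <;> fin_cases j <;>
    simp [SimpleGraph.pathGraph_adj, hlu, huz, hlu.symm, huz.symm, hlz,
      T.adj_comm z l]

theorem nonempty_iso_pathGraph_two [Fintype V] {T : SimpleGraph V} (hT : T.IsTree)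
    (hV : Fintype.card V = 2) : Nonempty (SimpleGraph.pathGraph 2 ≃g T) := by
  have : Nontrivial V := Fintype.one_lt_card_iff_nontrivial.1 (by omega)
  obtain ⟨l, hl⟩ := hT.exists_vert_degree_one_of_nontrivial
  obtain ⟨u, hu⟩ := exists_forall_adj_iff_of_degree_eq_one hl
  have hlu := (hu u).2 rfl
  have hinj : Function.Injective ![l, u] := by
    intro i j
    fin_cases i <;> fin_cases j <;> simp [hlu.ne, hlu.ne']
  refine ⟨⟨Equiv.ofBijective _ ((Fintype.bijective_iff_injective_and_card _).2
    ⟨hinj, by simp [hV]⟩), fun {i j} => ?_⟩⟩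
  fin_cases i <;> fin_cases j <;>
    simp [SimpleGraph.pathGraph_adj, hlu, hlu.symm]

/-- A leaf of a tree can be split off. -/
theorem exists_iso_attachPendants_unit {V : Type v} [Fintype V] {T : SimpleGraph V}
    (hT : T.IsTree) {l u : V} (hlu : ∀ w, T.Adj l w ↔ w = u) :
    ∃ (W : Type v) (_ : Fintype W) (C : SimpleGraph W) (u' : W)
      (e : attachPendants C (fun _ : Unit => u') ≃g T),
      C.IsTree ∧ e (Sum.inr ()) = l ∧ e (Sum.inl u') = u := by
  have hul : u ≠ l := ((hlu u).2 rfl).ne'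
  obtain ⟨h1, f, e, he⟩ := exists_iso_attachPendants_induce hT {l}ᶜ fun v hv => by
    obtain rfl : v = l := by simpa using hv
    exact ⟨u, hul, hlu⟩
  let e' : Unit ≃ {v // v ∉ ({l}ᶜ : Set V)} :=
    ⟨fun _ => ⟨l, by simp⟩, fun _ => (), fun _ => rfl, fun x => Subtype.ext (by
      have := x.2
      simp only [Set.mem_compl_iff, Set.mem_singleton_iff, not_not] at this
      exact this.symm)⟩
  have hfl : (e.symm (Sum.inr (e' ()))) = l := by
    by_contra hne
    have h2 := he ⟨_, hne⟩
    simp at h2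
  have hfu : f (e' ()) = ⟨u, hul⟩ := by
    have h3 : (attachPendants (T.induce {l}ᶜ) f).Adj (Sum.inr (e' ())) (Sum.inl (f (e' ()))) := by simp
    rw [← e.symm.map_adj_iff, hfl, he, hlu] at h3
    exact Subtype.ext h3
  refine ⟨_, inferInstance, T.induce {l}ᶜ, ⟨u, hul⟩,
    (attachPendantsIso SimpleGraph.Iso.refl e' (f := fun _ => ⟨u, hul⟩) (g := f)
      fun _ => hfu).trans e.symm, h1, ?_, ?_⟩
  · exact hfl
  · exact he ⟨u, hul⟩

end Trees

/-! ### Moving pendant vertices -/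

section MovePendants

open Finset Matrix

/-- The inequality behind the move of pendant vertices. On the left the weights of `u` and `z` are
raised by `1` and `a`; the right side is the expansion along a pendant vertex of weight `a + 1` at
`u`. -/
theorem permanent_add_diagonal_lt {α : Type*} [Fintype α] [DecidableEq α] {X : Matrix α α ℤ}
    (h₀ : ∀ i j, 0 ≤ X i j) (h₁ : ∀ i, 0 < X i i) {u z : α} (huz : u ≠ z) (hu : 2 ≤ X u u)
    (hz : 2 ≤ X z z) {a : ℤ} (ha : 0 < a) :
    (X + diagonal (Pi.single u 1) + diagonal (Pi.single z a)).permanent <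
      (a + 1) * X.permanent + minorPermanent X u := by
  -- `minorPermanent Z u` is the minor of `X` without both `u` and `z`. Expanding at `z`, the claim
  -- becomes `minorPermanent X z + minorPermanent Z u < X.permanent`, where each of these three
  -- quantities is at most half of the next larger one.
  set Z := X.updateCol z (Pi.single z 1) with hZ
  have hZ₀ : ∀ i j, 0 ≤ Z i j := by
    intro i j
    by_cases hj : j = z
    · subst hj
      by_cases hi : i = j
      · subst hi; simp [hZ]
      · simp [hZ, hi]
    · simp [hZ, hj, h₀]
  have h1 : minorPermanent (X + diagonal (Pi.single u 1)) z =
      minorPermanent X z + minorPermanent Z u := by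
    have h : (X + diagonal (Pi.single u 1)).updateCol z (Pi.single z 1) =
        Z + diagonal (Pi.single u 1) := by
      ext i j
      by_cases hj : j = z
      · subst hj
        by_cases hi : i = j
        · subst hi; simp [hZ, huz.symm]
        · simp [hZ, hi]
      · simp [hZ, hj]
    rw [minorPermanent, h, permanent_add_diagonal_single, one_mul]
    rfl
  have hpos : 0 < X.permanent :=
    (prod_pos fun i _ => h₁ i).trans_le (prod_diag_le_permanent h₀)
  have hm0 : 0 ≤ minorPermanent X z := permanent_nonneg hZ₀
  have hm2 : 0 ≤ minorPermanent Z u := permanent_nonneg fun i j => by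
    by_cases hj : j = u
    · subst hj
      by_cases hi : i = j
      · subst hi; simp
      · simp [hi]
    · simp [hj, hZ₀]
  have h2 := mul_minorPermanent_le h₀ z
  have h3 : Z u u * minorPermanent Z u ≤ minorPermanent X z := mul_minorPermanent_le hZ₀ u
  have hZu : Z u u = X u u := by simp [hZ, huz]
  rw [hZu] at h3
  rw [permanent_add_diagonal_single, permanent_add_diagonal_single, h1]
  have h4 : minorPermanent X z + minorPermanent Z u < X.permanent := by nlinarith
  nlinarith

end MovePendants

section Core

open Finset
open scoped Classical

universe v w

variable {V : Type w} {W : Type v} [Fintype V] [Fintype W]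

/-- A tree `C` with a proper 2-colouring `c` that is the subtree of non-leaves of the tree
obtained from it by attaching `k w` pendant vertices to each vertex `w`. -/
structure IsCore (C : SimpleGraph W) (k : W → ℕ) (c : W → Bool) : Prop where
  isTree : C.IsTree
  leaf : ∀ w, C.degree w = 1 → 1 ≤ k w
  ne : ∀ u v, C.Adj u v → c u ≠ c v

/-- The number of vertices of colour `b` in the tree obtained from a tree with 2-colouring `c`
by attaching `k w` pendant vertices to each vertex `w`. -/
def classSize (k : W → ℕ) (c : W → Bool) (b : Bool) : ℕ := ∑ w, if c w = b then 1 else k w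

/-- The Laplacian permanent of the tree obtained from `C` by attaching `k w` pendant vertices to
each vertex `w`. -/
noncomputable def corePermanent (C : SimpleGraph W) (k : W → ℕ) : ℤ :=
  weightedPermanent C fun w => (C.degree w : ℤ) + 2 * k w

theorem corePermanent_congr {C : SimpleGraph V} {D : SimpleGraph W} (e : C ≃g D) (k : W → ℕ) :
    corePermanent C (k ∘ e) = corePermanent D k :=
  weightedPermanent_congr e fun v => by simp

theorem classSize_congr (e : V ≃ W) (k : W → ℕ) (c : W → Bool) (b : Bool) :
    classSize (k ∘ e) (c ∘ e) b = classSize k c b :=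
  Fintype.sum_equiv e _ _ fun _ => rfl

theorem IsCore.congr {C : SimpleGraph V} {D : SimpleGraph W} (e : C ≃g D) {k : W → ℕ}
    {c : W → Bool} (h : IsCore D k c) : IsCore C (k ∘ e) (c ∘ e) where
  isTree := (SimpleGraph.Iso.isTree_iff e).2 h.isTree
  leaf w hw := h.leaf _ (by rw [e.degree_eq, hw])
  ne u v huv := h.ne _ _ (e.map_adj_iff.2 huv)

/-- Moving the pendant vertices of a pendant core vertex `Sum.inr ()` to another core vertex
decreases the permanent. -/
theorem corePermanent_attachPendants_lt {C : SimpleGraph W} {u z : W} (huz : u ≠ z)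
    {k : W ⊕ Unit → ℕ}
    (hpos : ∀ w, 1 ≤ (attachPendants C fun _ : Unit => u).degree (Sum.inl w))
    (hk : 1 ≤ k (Sum.inr ()))
    (hu : 2 ≤ (attachPendants C fun _ : Unit => u).degree (Sum.inl u) + 2 * k (Sum.inl u))
    (hz : 2 ≤ (attachPendants C fun _ : Unit => u).degree (Sum.inl z) + 2 * k (Sum.inl z)) :
    corePermanent C (fun w => k (Sum.inl w) + (if u = w then 1 else 0) +
      if z = w then k (Sum.inr ()) else 0) <
      corePermanent (attachPendants C fun _ : Unit => u) k := by
  unfold corePermanent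
  rw [weightedPermanent_attachPendants_unit, degree_attachPendants_inr]
  set x : W ⊕ Unit → ℤ := fun w =>
    ((attachPendants C fun _ : Unit => u).degree w : ℤ) + 2 * k w with hx
  have h : (fun w => (C.degree w : ℤ) + 2 * ((k (Sum.inl w) + (if u = w then 1 else 0) +
      if z = w then k (Sum.inr ()) else 0 : ℕ) : ℤ)) =
      x ∘ Sum.inl + Pi.single u 1 + Pi.single z (2 * (k (Sum.inr ()) : ℤ)) := by
    ext w
    simp only [hx, Function.comp, Pi.add_apply, Pi.single_apply, degree_attachPendants_inl,
      pendantCount_const, Fintype.card_unit, eq_comm (a := w)]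
    push_cast
    split_ifs <;> ring
  have hsum : Matrix.diagonal (x ∘ Sum.inl + Pi.single u 1 +
      Pi.single z (2 * (k (Sum.inr ()) : ℤ))) + C.adjMatrix ℤ =
      Matrix.diagonal (x ∘ Sum.inl) + C.adjMatrix ℤ + Matrix.diagonal (Pi.single u 1) +
        Matrix.diagonal (Pi.single z (2 * (k (Sum.inr ()) : ℤ))) := by
    ext i j
    by_cases hij : i = j
    · subst hij
      simp
    · simp [hij]
  rw [h, weightedPermanent_eq, weightedPermanent_eq, hsum]
  have hx1 : ∀ w, 1 ≤ x (Sum.inl w) := fun w => by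
    have := hpos w
    simp only [hx]
    omega
  have hd : ∀ w, (Matrix.diagonal (x ∘ Sum.inl) + C.adjMatrix ℤ) w w = x (Sum.inl w) := by simp
  have := permanent_add_diagonal_lt (X := Matrix.diagonal (x ∘ Sum.inl) + C.adjMatrix ℤ)
    (u := u) (z := z) (a := 2 * (k (Sum.inr ()) : ℤ)) (fun i j => ?_) (fun i => ?_) huz ?_ ?_ ?_
  · convert this using 2
    push_cast
    ring
  · by_cases hij : i = j
    · subst hij
      rw [hd]
      linarith [hx1 i]
    · simp only [Matrix.add_apply, Matrix.diagonal_apply_ne _ hij, SimpleGraph.adjMatrix_apply]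
      split_ifs <;> simp
  · rw [hd]
    linarith [hx1 i]
  · rw [hd]
    simp only [hx]
    omega
  · rw [hd]
    simp only [hx]
    omega
  · omega

/-- The move for a core in which the leaf to be removed is the vertex `Sum.inr ()`, attached to `u`.
It becomes a pendant vertex of `u`, and its pendant vertices are moved to `z`. -/
theorem IsCore.move {C : SimpleGraph W} (hC : C.IsTree) {u z : W} {k : W ⊕ Unit → ℕ}
    {c : W ⊕ Unit → Bool} (h : IsCore (attachPendants C fun _ : Unit => u) k c)
    (hz : c (Sum.inl z) = c (Sum.inr ())) {k' : W → ℕ}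
    (hk' : ∀ w, k' w = k (Sum.inl w) + (if u = w then 1 else 0) +
      if z = w then k (Sum.inr ()) else 0) :
    IsCore C k' (c ∘ Sum.inl) ∧ (∀ b, classSize k' (c ∘ Sum.inl) b = classSize k c b) ∧
      corePermanent C k' < corePermanent (attachPendants C fun _ : Unit => u) k := by
  have hu : c (Sum.inl u) = !c (Sum.inr ()) := by
    have h1 := h.ne (Sum.inl u) (Sum.inr ()) rfl
    revert h1
    cases c (Sum.inl u) <;> cases c (Sum.inr ()) <;> simp
  have huz : u ≠ z := by
    rintro rfl
    rw [hz] at hu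
    revert hu
    cases c (Sum.inr ()) <;> simp
  have hdeg : ∀ w, (attachPendants C fun _ : Unit => u).degree (Sum.inl w) =
      C.degree w + if u = w then 1 else 0 := fun w => by
    rw [degree_attachPendants_inl, pendantCount_const, Fintype.card_unit]
  have hpos : ∀ w, 1 ≤ (attachPendants C fun _ : Unit => u).degree (Sum.inl w) := fun w =>
    have : Nontrivial (W ⊕ Unit) := ⟨Sum.inl u, Sum.inr (), by simp⟩
    h.isTree.connected.preconnected.degree_pos_of_nontrivial _
  have htwo : ∀ w, 2 ≤ (attachPendants C fun _ : Unit => u).degree (Sum.inl w) +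
      2 * k (Sum.inl w) := fun w => by
    have h1 := hpos w
    have h2 := h.leaf (Sum.inl w)
    omega
  refine ⟨⟨hC, fun w hw => ?_, fun v w hvw => h.ne (Sum.inl v) (Sum.inl w) hvw⟩, fun b => ?_, ?_⟩
  · rw [hk']
    by_cases huw : u = w
    · rw [if_pos huw]
      omega
    · have h1 := h.leaf (Sum.inl w) (by rw [hdeg, hw, if_neg huw])
      omega
  · have h1 : ∀ w, (if (c ∘ Sum.inl) w = b then 1 else k' w) =
        (if c (Sum.inl w) = b then 1 else k (Sum.inl w)) +
          ((if u = w then (if c (Sum.inr ()) = b then 1 else 0) else 0) +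
          (if z = w then (if c (Sum.inr ()) = b then 0 else k (Sum.inr ())) else 0)) := by
      intro w
      rw [hk', Function.comp]
      by_cases h2 : u = w
      · subst h2
        rw [hu]
        cases c (Sum.inr ()) <;> cases b <;> simp [huz.symm]
      · by_cases h3 : z = w
        · subst h3
          rw [hz]
          cases c (Sum.inr ()) <;> cases b <;> simp [huz]
        · simp [h2, h3]
    unfold classSize
    simp only [h1, sum_add_distrib, sum_ite_eq, mem_univ, if_true, Fintype.sum_sum_type,
      univ_unique, sum_singleton]
    congr 1
    change _ = if c (Sum.inr ()) = b then 1 else k (Sum.inr ())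
    split_ifs <;> simp
  · rw [funext hk']
    exact corePermanent_attachPendants_lt huz hpos
      (h.leaf _ (degree_attachPendants_inr _ _ _)) (htwo _) (htwo _)

/-- Moving the pendant vertices of a leaf `l` of the core to a core vertex `z` of the same colour
gives a tree with the same class sizes, a smaller core and a smaller Laplacian permanent. -/
theorem IsCore.exists_smaller {C : SimpleGraph W} {k : W → ℕ} {c : W → Bool} (h : IsCore C k c)
    (hW : 3 ≤ Fintype.card W) {l : W} (hl : C.degree l = 1) :
    (∃ z, z ≠ l ∧ c z = c l) ∧
    ∃ (W' : Type v) (_ : Fintype W') (C' : SimpleGraph W') (k' : W' → ℕ) (c' : W' → Bool),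
      IsCore C' k' c' ∧ (∀ b, classSize k' c' b = classSize k c b) ∧
      Fintype.card W' + 1 = Fintype.card W ∧
      (∀ b, #{w | c' w = b} + (if c l = b then 1 else 0) = #{w | c w = b}) ∧
      corePermanent C' k' < corePermanent C k := by
  obtain ⟨u, z, hlu, huz, hzl⟩ := exists_path_of_degree_eq_one h.isTree.connected hW hl
  have hlu' := (hlu u).2 rfl
  have hcz : c z = c l := by
    have h1 := h.ne _ _ hlu'
    have h2 := h.ne _ _ huz
    revert h1 h2
    cases c l <;> cases c u <;> cases c z <;> simp
  refine ⟨⟨z, hzl, hcz⟩, ?_⟩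
  obtain ⟨W', _, C', u', e, hC', hel, heu⟩ := exists_iso_attachPendants_unit h.isTree hlu
  obtain ⟨z', hez⟩ : ∃ z', e (Sum.inl z') = z := by
    obtain ⟨(z' | z'), hz'⟩ := e.surjective z
    · exact ⟨z', hz'⟩
    · exact absurd (hz'.symm.trans hel) hzl
  have hcz' : (c ∘ e) (Sum.inl z') = (c ∘ e) (Sum.inr ()) := by simp [hez, hel, hcz]
  obtain ⟨h1, h2, h3⟩ := (h.congr e).move hC' hcz' fun _ => rfl
  refine ⟨W', inferInstance, C', _, _, h1, fun b => ?_, ?_, fun b => ?_, ?_⟩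
  · rw [h2]
    exact classSize_congr e.toEquiv k c b
  · rw [← Fintype.card_congr e.toEquiv]
    simp
  · rw [card_filter, card_filter, ← Equiv.sum_comp e.toEquiv, Fintype.sum_sum_type]
    simp [hel]
  · rwa [corePermanent_congr e] at h3

end Core

/-! ### Lower bounds for large cores -/

section Bounds

open Finset
open scoped Classical

universe v

variable {W : Type v} [Fintype W]

theorem degree_pathGraph_two (i : Fin 2) : (SimpleGraph.pathGraph 2).degree i = 1 := by
  rw [degree_eq_sum, Fin.sum_univ_two]
  fin_cases i <;> simp [SimpleGraph.pathGraph_adj]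

theorem degree_pathGraph_three (i : Fin 3) :
    (SimpleGraph.pathGraph 3).degree i = ![1, 2, 1] i := by
  rw [degree_eq_sum, Fin.sum_univ_three]
  fin_cases i <;> simp [SimpleGraph.pathGraph_adj]

theorem corePermanent_pathGraph_two (k : Fin 2 → ℕ) :
    corePermanent (SimpleGraph.pathGraph 2) k = (2 * k 0 + 1) * (2 * k 1 + 1) + 1 := by
  have hu : (univ : Finset (Equiv.Perm (Fin 2))) = {1, Equiv.swap 0 1} := by decide
  unfold corePermanent
  rw [weightedPermanent_eq, Matrix.permanent, hu, sum_insert (by decide), sum_singleton]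
  simp [degree_pathGraph_two, Fin.prod_univ_two, SimpleGraph.pathGraph_adj,
    SimpleGraph.adjMatrix_apply]
  ring

theorem corePermanent_pathGraph_three (k : Fin 3 → ℕ) :
    corePermanent (SimpleGraph.pathGraph 3) k =
      (2 * k 0 + 1) * (2 * k 1 + 2) * (2 * k 2 + 1) + (2 * k 0 + 1) + (2 * k 2 + 1) := by
  have hu : (univ : Finset (Equiv.Perm (Fin 3))) = {1, Equiv.swap 0 1, Equiv.swap 1 2,
    Equiv.swap 0 2, Equiv.swap 0 1 * Equiv.swap 1 2, Equiv.swap 1 2 * Equiv.swap 0 1} := by decide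
  unfold corePermanent
  rw [weightedPermanent_eq, Matrix.permanent, hu, sum_insert (by decide), sum_insert (by decide),
    sum_insert (by decide), sum_insert (by decide), sum_insert (by decide), sum_singleton]
  simp [degree_pathGraph_three, Fin.prod_univ_three, SimpleGraph.pathGraph_adj,
    SimpleGraph.adjMatrix_apply, Equiv.swap_apply_def, Matrix.diagonal_apply]
  ring

theorem IsCore.color_pathGraph_three {k : Fin 3 → ℕ} {c : Fin 3 → Bool}
    (h : IsCore (SimpleGraph.pathGraph 3) k c) :
    c 1 = !c 0 ∧ c 2 = c 0 ∧ 1 ≤ k 0 ∧ 1 ≤ k 2 := by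
  have h1 := h.ne 0 1 (by simp [SimpleGraph.pathGraph_adj])
  have h2 := h.ne 1 2 (by simp [SimpleGraph.pathGraph_adj])
  have h3 := h.leaf 0 (by simp [degree_pathGraph_three])
  have h4 := h.leaf 2 (by simp [degree_pathGraph_three])
  refine ⟨?_, ?_, h3, h4⟩ <;> revert h1 h2 <;> cases c 0 <;> cases c 1 <;> cases c 2 <;> simp

theorem IsCore.one_le_degree {C : SimpleGraph W} {k : W → ℕ} {c : W → Bool}
    (h : IsCore C k c) (hW : 2 ≤ Fintype.card W) (w : W) : 1 ≤ C.degree w :=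
  have : Nontrivial W := Fintype.one_lt_card_iff_nontrivial.1 hW
  h.isTree.connected.preconnected.degree_pos_of_nontrivial _

theorem IsCore.exists_leaf {C : SimpleGraph W} {k : W → ℕ} {c : W → Bool}
    (h : IsCore C k c) (hW : 2 ≤ Fintype.card W) : ∃ l, C.degree l = 1 :=
  have : Nontrivial W := Fintype.one_lt_card_iff_nontrivial.1 hW
  h.isTree.exists_vert_degree_one_of_nontrivial

theorem card_color_add (c : W → Bool) (b : Bool) :
    #{w | c w = b} + #{w | c w = !b} = Fintype.card W := by
  have := card_filter_add_card_filter_not (s := (univ : Finset W)) (fun w => c w = b)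
  rw [card_univ] at this
  rw [← this]
  congr 2
  ext w
  cases c w <;> cases b <;> simp

/-- If only two core vertices have colour `b`, then some leaf of the core has the other colour:
the vertices of the other colour are at least two in number, and the sum of their degrees exceeds
their number by one only. -/
theorem IsCore.exists_leaf_color {C : SimpleGraph W} {k : W → ℕ} {c : W → Bool}
    (h : IsCore C k c) (hW : 4 ≤ Fintype.card W) {b : Bool} (hb : #{w | c w = b} = 2) :
    ∃ l, C.degree l = 1 ∧ c l ≠ b := by
  by_contra! hcon
  have h1 := sum_degree_color h.isTree c h.ne (!b)
  have h2 := card_color_add c b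
  have h3 : ∑ v with c v = !b, 2 ≤ ∑ v with c v = !b, C.degree v := by
    refine sum_le_sum fun v hv => ?_
    have h4 := h.one_le_degree (by omega) v
    have h5 := hcon v
    simp only [mem_filter, mem_univ, true_and] at hv
    rw [hv] at h5
    by_contra h6
    have := h5 (by omega)
    cases b <;> simp at this
  rw [sum_const, smul_eq_mul] at h3
  omega

/-- The lower bound for cores with at least two vertices of colour `b`. -/
theorem IsCore.bound_of_two_le {C : SimpleGraph W} {k : W → ℕ} {c : W → Bool}
    (h : IsCore C k c) (hW : 3 ≤ Fintype.card W) (b : Bool) (hb : 2 ≤ #{w | c w = b}) :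
    (2 * (classSize k c !b : ℤ) - 3) * (6 * classSize k c b - 5) + 3 ≤ corePermanent C k ∧
    (4 ≤ Fintype.card W →
      (2 * (classSize k c !b : ℤ) - 3) * (6 * classSize k c b - 5) + 3 < corePermanent C k) := by
  induction hn : Fintype.card W using Nat.strong_induction_on generalizing W with
  | _ n ih =>
  rcases eq_or_lt_of_le hW with h3 | h4
  -- The core is a path whose two ends have colour `b`.
  · refine ⟨?_, fun h4 => by omega⟩
    obtain ⟨e⟩ := nonempty_iso_pathGraph_three h.isTree h3.symm c h.ne
    obtain ⟨h1, h2, h0, h0'⟩ := (h.congr e).color_pathGraph_three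
    have hcb : (c ∘ e) 0 = b := by
      by_contra hne
      have hle : #{w | c w = b} ≤ #{e 1} := card_le_card fun w hw => by
        obtain ⟨i, rfl⟩ := e.surjective w
        have hw : (c ∘ e) i = b := (mem_filter.1 hw).2
        fin_cases i
        · exact absurd hw hne
        · exact mem_singleton_self _
        · exact absurd (h2.symm.trans hw) hne
      simp at hle
      omega
    rw [hcb] at h1 h2
    have hp : classSize k c b = 2 + (k ∘ e) 1 := by
      rw [← classSize_congr e.toEquiv, classSize, Fin.sum_univ_three]
      change (if (c ∘ e) 0 = b then 1 else (k ∘ e) 0) + (if (c ∘ e) 1 = b then 1 else (k ∘ e) 1) +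
        (if (c ∘ e) 2 = b then 1 else (k ∘ e) 2) = _
      rw [hcb, h1, h2]
      cases b <;> simp <;> ring
    have hq : classSize k c (!b) = 1 + (k ∘ e) 0 + (k ∘ e) 2 := by
      rw [← classSize_congr e.toEquiv, classSize, Fin.sum_univ_three]
      change (if (c ∘ e) 0 = _ then 1 else (k ∘ e) 0) + (if (c ∘ e) 1 = _ then 1 else (k ∘ e) 1) +
        (if (c ∘ e) 2 = _ then 1 else (k ∘ e) 2) = _
      rw [hcb, h1, h2]
      cases b <;> simp <;> ring
    rw [hp, hq, ← corePermanent_congr e, corePermanent_pathGraph_three]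
    generalize (k ∘ e) 0 = x at *
    generalize (k ∘ e) 1 = y at *
    generalize (k ∘ e) 2 = z at *
    obtain ⟨x, rfl⟩ := Nat.exists_eq_add_of_le' h0
    obtain ⟨z, rfl⟩ := Nat.exists_eq_add_of_le' h0'
    push_cast
    nlinarith [show (0 : ℤ) ≤ x * z by positivity, show (0 : ℤ) ≤ x * z * y by positivity]
  -- Remove a core leaf such that two vertices of colour `b` remain.
  · obtain ⟨l, hl, hlb⟩ : ∃ l, C.degree l = 1 ∧ 2 + (if c l = b then 1 else 0) ≤
        #{w | c w = b} := by
      rcases eq_or_lt_of_le hb with hb2 | hb3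
      · obtain ⟨l, hl, hlb⟩ := h.exists_leaf_color h4 hb2.symm
        exact ⟨l, hl, by rw [if_neg hlb]; exact hb⟩
      · obtain ⟨l, hl⟩ := h.exists_leaf (by omega)
        exact ⟨l, hl, by split_ifs <;> omega⟩
    obtain ⟨-, W', _, C', k', c', h', hs, hcard, hcol, hlt⟩ := h.exists_smaller hW hl
    have := (ih _ (by omega) h' (by omega) (by have := hcol b; omega) rfl).1
    rw [hs, hs] at this
    exact ⟨(this.trans_lt hlt).le, fun _ => this.trans_lt hlt⟩

/-- The lower bound for cores with exactly one vertex of colour `b`, which are stars. -/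
theorem IsCore.bound_of_eq_one {C : SimpleGraph W} {k : W → ℕ} {c : W → Bool}
    (h : IsCore C k c) (hW : 4 ≤ Fintype.card W) (b : Bool) (hb : #{w | c w = b} = 1) :
    (2 * (classSize k c !b : ℤ) - 3) * (6 * classSize k c b - 5) + 3 < corePermanent C k := by
  induction hn : Fintype.card W using Nat.strong_induction_on generalizing W with
  | _ n ih =>
  rcases eq_or_lt_of_le hW with h4 | h5
  -- The core is a star with centre `u` and leaves `x, y, z`.
  · have hcol := card_color_add c b
    obtain ⟨u, hu⟩ := card_eq_one.1 hb
    obtain ⟨x, y, z, hxy, hxz, hyz, hxyz⟩ := card_eq_three.1 (show #{w | c w = !b} = 3 by omega)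
    have hmem : ∀ w, w ∈ univ.filter (fun w => c w = !b) ↔ c w = !b := by simp
    have hdeg : ∀ w, c w = (!b) → C.degree w = 1 := by
      have h1 := sum_degree_color h.isTree c h.ne (!b)
      rw [hxyz, sum_insert (by simp [hxy, hxz]), sum_insert (by simp [hyz]), sum_singleton] at h1
      have hx := h.one_le_degree (by omega) x
      have hy := h.one_le_degree (by omega) y
      have hz := h.one_le_degree (by omega) z
      intro w hw
      rw [← hmem, hxyz] at hw
      simp only [mem_insert, mem_singleton] at hw
      rcases hw with rfl | rfl | rfl <;> omega
    have hdu : C.degree u = 3 := by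
      have h1 := sum_degree_color h.isTree c h.ne b
      rw [hu, sum_singleton] at h1
      omega
    have hsplit : ∀ {M : Type} [CommMonoid M] (f : W → M), ∏ w, f w = f u * (f x * (f y * f z)) := by
      intro M _ f
      rw [← prod_filter_mul_prod_filter_not univ (fun w => c w = b), hu, prod_singleton]
      have : univ.filter (fun w => ¬ c w = b) = {x, y, z} := by
        rw [← hxyz]
        ext w
        cases c w <;> cases b <;> simp
      rw [this, prod_insert (by simp [hxy, hxz]), prod_insert (by simp [hyz]), prod_singleton]
    have hcu : c u = b := by
      have : u ∈ univ.filter (fun w => c w = b) := by rw [hu]; simp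
      simpa using this
    have hcx : c x = !b := by rw [← hmem, hxyz]; simp
    have hcy : c y = !b := by rw [← hmem, hxyz]; simp
    have hcz : c z = !b := by rw [← hmem, hxyz]; simp
    have hsum : ∀ f : W → ℕ, ∑ w, f w = f u + (f x + (f y + f z)) := fun f =>
      hsplit (M := Multiplicative ℕ) f
    have hp : classSize k c b = 1 + (k x + (k y + k z)) := by
      rw [classSize, hsum, hcu, hcx, hcy, hcz]
      cases b <;> simp
    have hq : classSize k c (!b) = k u + 3 := by
      rw [classSize, hsum, hcu, hcx, hcy, hcz]
      cases b <;> simp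
    have hprod : (2 * k u + 3 : ℤ) * ((2 * k x + 1) * ((2 * k y + 1) * (2 * k z + 1))) ≤
        corePermanent C k := by
      refine le_trans (le_of_eq ?_) (prod_diag_le_permanent fun i j => ?_)
      · simp only [Matrix.add_apply, Matrix.diagonal_apply_eq, SimpleGraph.adjMatrix_apply,
          SimpleGraph.irrefl, if_false, add_zero]
        rw [hsplit, hdu, hdeg x hcx, hdeg y hcy, hdeg z hcz]
        push_cast
        ring
      · simp only [Matrix.add_apply, Matrix.diagonal_apply, SimpleGraph.adjMatrix_apply]
        split_ifs <;> positivity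
    refine lt_of_lt_of_le ?_ hprod
    have hx := h.leaf x (hdeg x hcx)
    have hy := h.leaf y (hdeg y hcy)
    have hz := h.leaf z (hdeg z hcz)
    rw [hp, hq]
    generalize k x = X at *
    generalize k y = Y at *
    generalize k z = Z at *
    generalize k u = U at *
    obtain ⟨X, rfl⟩ := Nat.exists_eq_add_of_le' hx
    obtain ⟨Y, rfl⟩ := Nat.exists_eq_add_of_le' hy
    obtain ⟨Z, rfl⟩ := Nat.exists_eq_add_of_le' hz
    -- Each of `X, Y, Z` is one less than the number of pendant vertices.
    have key : (6 * (X + Y + Z) + 27 : ℤ) ≤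
        (2 * ((X + 1 : ℕ) : ℤ) + 1) * ((2 * ((Y + 1 : ℕ) : ℤ) + 1) * (2 * ((Z + 1 : ℕ) : ℤ) + 1)) := by
      push_cast
      have h1 : (0 : ℤ) ≤ X * Y := by positivity
      have h2 : (0 : ℤ) ≤ X * Z := by positivity
      have h3 : (0 : ℤ) ≤ Y * Z := by positivity
      have h4 : (0 : ℤ) ≤ X * Y * Z := by positivity
      nlinarith
    have := mul_le_mul_of_nonneg_left key (show (0 : ℤ) ≤ 2 * U + 3 by positivity)
    refine lt_of_lt_of_le ?_ this
    push_cast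
    nlinarith
  · obtain ⟨l, hl⟩ := h.exists_leaf (by omega)
    obtain ⟨⟨z, hzl, hcz⟩, W', _, C', k', c', h', hs, hcard, hcol, hlt⟩ :=
      h.exists_smaller (by omega) hl
    have hlb : c l ≠ b := fun hlb => by
      have h1 := card_eq_one.1 hb
      obtain ⟨u, hu⟩ := h1
      have hz : z ∈ univ.filter (fun w => c w = b) := by simp [hcz, hlb]
      have hl : l ∈ univ.filter (fun w => c w = b) := by simp [hlb]
      rw [hu, mem_singleton] at hz hl
      exact hzl (hz.trans hl.symm)
    have h1 := hcol b
    rw [if_neg hlb] at h1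
    have := ih _ (by omega) h' (by omega) (by omega) rfl
    rw [hs, hs] at this
    exact this.trans hlt

/-- Every tree with at least four non-leaves, with class sizes `p` and `q`, has Laplacian
permanent larger than `(2 q - 3) (6 p - 5) + 3`. -/
theorem IsCore.bound {C : SimpleGraph W} {k : W → ℕ} {c : W → Bool}
    (h : IsCore C k c) (hW : 4 ≤ Fintype.card W) (b : Bool) :
    (2 * (classSize k c !b : ℤ) - 3) * (6 * classSize k c b - 5) + 3 < corePermanent C k := by
  have h0 : #{w | c w = b} ≠ 0 := fun h0 => by
    have h1 := sum_degree_color h.isTree c h.ne b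
    rw [card_eq_zero.1 h0, sum_empty] at h1
    omega
  rcases eq_or_ne #{w | c w = b} 1 with h1 | h1
  · exact h.bound_of_eq_one hW b h1
  · exact (h.bound_of_two_le (by omega) b (by omega)).2 hW

end Bounds

/-! ### Bipartitions and small cores -/

section Bipartition

open Finset
open scoped Classical

universe v w

variable {V : Type v} {W : Type w} {ι : Type*} [Fintype V] [Fintype W] [Fintype ι]

theorem isBipartitionedTree_of_color {T : SimpleGraph V} (hT : T.IsTree) (c : V → Bool)
    (hc : ∀ u v, T.Adj u v → c u ≠ c v) {p q : ℕ} (hp : #{v | c v = true} = p)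
    (hq : #{v | c v = false} = q) : IsBipartitionedTree T p q := by
  refine ⟨hT, {v | c v = true}, {v | c v = false}, ⟨?_, fun u v huv => ?_⟩, ?_, ?_, ?_⟩
  · rw [Set.disjoint_left]
    intro v h1 h2
    exact Bool.false_ne_true ((show c v = false from h2).symm.trans h1)
  · have := hc u v huv
    change (c u = true ∧ c v = false) ∨ (c u = false ∧ c v = true)
    revert this
    cases c u <;> cases c v <;> simp
  · ext v
    change (c v = true ∨ c v = false) ↔ True
    cases c v <;> simp
  · rw [← hp, ← Set.encard_coe_eq_coe_finsetCard]
    congr 1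
    ext v
    simp
  · rw [← hq, ← Set.encard_coe_eq_coe_finsetCard]
    congr 1
    ext v
    simp

theorem IsBipartitionedTree.exists_color {T : SimpleGraph V} {p q : ℕ}
    (h : IsBipartitionedTree T p q) : ∃ c : V → Bool, (∀ u v, T.Adj u v → c u ≠ c v) ∧
      #{v | c v = true} = p ∧ #{v | c v = false} = q := by
  obtain ⟨-, V₁, V₂, hb, huniv, h1, h2⟩ := h
  have hmem : ∀ v, v ∉ V₁ ↔ v ∈ V₂ := fun v =>
    ⟨fun hv => (huniv.ge (Set.mem_univ v)).resolve_left hv,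
      fun hv hv' => Set.disjoint_left.1 hb.disjoint hv' hv⟩
  refine ⟨fun v => decide (v ∈ V₁), fun u v huv => ?_, ?_, ?_⟩
  · rcases hb.mem_of_adj huv with ⟨hu, hv⟩ | ⟨hu, hv⟩
    · rw [← hmem] at hv
      simp [hu, hv]
    · rw [← hmem] at hu
      simp [hu, hv]
  · have h3 : ((univ.filter fun v => decide (v ∈ V₁) = true : Finset V) : Set V) = V₁ := by
      ext v
      simp
    rw [← h3, Set.encard_coe_eq_coe_finsetCard] at h1
    exact_mod_cast h1
  · have h3 : ((univ.filter fun v => decide (v ∈ V₁) = false : Finset V) : Set V) = V₂ := by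
      ext v
      simp [hmem]
    rw [← h3, Set.encard_coe_eq_coe_finsetCard] at h2
    exact_mod_cast h2

theorem IsBipartitionedTree.congr {T : SimpleGraph V} {U : SimpleGraph W} (e : T ≃g U) {p q : ℕ}
    (h : IsBipartitionedTree U p q) : IsBipartitionedTree T p q := by
  obtain ⟨c, hc, h1, h2⟩ := h.exists_color
  have hcard : ∀ b, #{v | (c ∘ e) v = b} = #{v | c v = b} := fun b => by
    rw [card_filter, card_filter]
    exact Fintype.sum_equiv e.toEquiv _ _ fun _ => rfl
  exact isBipartitionedTree_of_color ((SimpleGraph.Iso.isTree_iff e).2 h.1) (c ∘ e)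
    (fun u v huv => hc _ _ (e.map_adj_iff.2 huv)) ((hcard _).trans h1) ((hcard _).trans h2)

theorem card_color_attachPendants (f : ι → W) (c : W ⊕ ι → Bool)
    (hc : ∀ i, c (Sum.inr i) = !c (Sum.inl (f i))) (b : Bool) :
    #{v | c v = b} = classSize (pendantCount f) (c ∘ Sum.inl) b := by
  rw [card_filter, Fintype.sum_sum_type, classSize]
  have h : (∑ i, if c (Sum.inr i) = b then 1 else 0) =
      ∑ w, ∑ i with f i = w, if c (Sum.inl w) = b then 0 else 1 := by
    rw [← sum_fiberwise univ f]
    refine sum_congr rfl fun w _ => sum_congr rfl fun i hi => ?_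
    rw [hc, (mem_filter.1 hi).2]
    cases c (Sum.inl w) <;> cases b <;> simp
  rw [h, ← sum_add_distrib]
  refine sum_congr rfl fun w _ => ?_
  rw [sum_const, pendantCount, Function.comp]
  split_ifs <;> simp

theorem isBipartitionedTree_attachPendants {C : SimpleGraph W} (hC : C.IsTree) (f : ι → W)
    (c : W → Bool) (hc : ∀ u v, C.Adj u v → c u ≠ c v) :
    IsBipartitionedTree (attachPendants C f) (classSize (pendantCount f) c true)
      (classSize (pendantCount f) c false) := by
  refine isBipartitionedTree_of_color (isTree_attachPendants hC f)
    (Sum.elim c fun i => !c (f i)) ?_ (card_color_attachPendants f _ (fun _ => rfl) true)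
    (card_color_attachPendants f _ (fun _ => rfl) false)
  rintro (u | i) (v | j) h
  · exact hc u v h
  · obtain rfl : u = f j := h
    simp
  · obtain rfl : v = f i := h
    simp
  · exact h.elim

/-- A bipartitioned tree with at least three vertices is determined by its core, and the sizes of its
classes can be read off from the core. -/
theorem IsBipartitionedTree.exists_isCore {T : SimpleGraph V} {p q : ℕ}
    (h : IsBipartitionedTree T p q) (hpq : 3 ≤ p + q) :
    ∃ (W : Type v) (_ : Fintype W) (C : SimpleGraph W) (ι : Type v) (_ : Fintype ι) (f : ι → W)
      (c : W → Bool), IsCore C (pendantCount f) c ∧ Nonempty (T ≃g attachPendants C f) ∧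
        classSize (pendantCount f) c true = p ∧ classSize (pendantCount f) c false = q := by
  obtain ⟨c, hc, h1, h2⟩ := h.exists_color
  have hV : 3 ≤ Fintype.card V := by
    rw [← card_color_add c true]
    simp only [Bool.not_true]
    omega
  obtain ⟨W, _, C, ι, _, f, hC, hleaf, ⟨e⟩⟩ := exists_core h.1 hV
  have hce : ∀ u v, (attachPendants C f).Adj u v → (c ∘ e.symm) u ≠ (c ∘ e.symm) v :=
    fun u v huv => hc _ _ (e.symm.map_adj_iff.2 huv)
  have hcard : ∀ b, #{v | (c ∘ e.symm) v = b} = #{v | c v = b} := fun b => by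
    rw [card_filter, card_filter]
    exact Fintype.sum_equiv e.symm.toEquiv _ _ fun _ => rfl
  have hpend : ∀ i, (c ∘ e.symm) (Sum.inr i) = !(c ∘ e.symm) (Sum.inl (f i)) := fun i => by
    have := hce (Sum.inr i) (Sum.inl (f i)) rfl
    revert this
    cases (c ∘ e.symm) (Sum.inr i) <;> cases (c ∘ e.symm) (Sum.inl (f i)) <;> simp
  refine ⟨W, inferInstance, C, ι, inferInstance, f, (c ∘ e.symm) ∘ Sum.inl,
    ⟨hC, hleaf, fun u v huv => hce _ _ huv⟩, ⟨e⟩, ?_, ?_⟩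
  · rw [← card_color_attachPendants f _ hpend, hcard, h1]
  · rw [← card_color_attachPendants f _ hpend, hcard, h2]

theorem classSize_eq_add (k : W → ℕ) (c : W → Bool) (b : Bool) :
    classSize k c b = #{w | c w = b} + ∑ w with c w = !b, k w := by
  rw [classSize, card_filter, sum_filter, ← sum_add_distrib]
  refine sum_congr rfl fun w _ => ?_
  cases c w <;> cases b <;> simp

/-- A tree with at least four non-leaves has at least three vertices in each class. -/
theorem IsCore.three_le_classSize {C : SimpleGraph W} {k : W → ℕ} {c : W → Bool}
    (h : IsCore C k c) (hW : 4 ≤ Fintype.card W) (b : Bool) : 3 ≤ classSize k c b := by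
  rw [classSize_eq_add]
  have h0 : #{w | c w = b} ≠ 0 := fun h0 => by
    have h1 := sum_degree_color h.isTree c h.ne b
    rw [card_eq_zero.1 h0, sum_empty] at h1
    omega
  rcases (show #{w | c w = b} = 1 ∨ #{w | c w = b} = 2 ∨ 3 ≤ #{w | c w = b} by omega) with
    h1 | h2 | h3
  · have hd := sum_degree_color h.isTree c h.ne (!b)
    have hcard := card_color_add c b
    have hk : ∑ w with c w = !b, 1 ≤ ∑ w with c w = !b, k w := by
      refine sum_le_sum fun w hw => h.leaf w ?_
      by_contra hne
      have h2 := h.one_le_degree (by omega)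
      have h3 : ∑ w with c w = !b, 1 < ∑ w with c w = !b, C.degree w :=
        sum_lt_sum (fun w _ => h2 w) ⟨w, hw, lt_of_le_of_ne (h2 w) (Ne.symm hne)⟩
      rw [sum_const, smul_eq_mul] at h3
      omega
    rw [sum_const, smul_eq_mul] at hk
    omega
  · obtain ⟨l, hl, hlb⟩ := h.exists_leaf_color hW h2
    have h3 : k l ≤ ∑ w with c w = !b, k w :=
      single_le_sum (fun _ _ => Nat.zero_le _) (mem_filter.2 ⟨mem_univ _, by
        revert hlb
        cases c l <;> cases b <;> simp⟩)
    have h4 := h.leaf l hl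
    omega
  · omega

end Bipartition

section SmallCores

open Finset

universe v

variable {V : Type v} {ι κ : Type*}

/-- Two families of pendant vertices can be attached one after the other. -/
def attachPendantsElimIso (G : SimpleGraph V) (f : ι → V) (g : κ → V) :
    attachPendants G (Sum.elim f g) ≃g
      attachPendants (attachPendants G f) (fun k => Sum.inl (g k)) where
  toEquiv := (Equiv.sumAssoc V ι κ).symm
  map_rel_iff' := by
    rintro (u | i | i) (v | j | j) <;> simp

/-- The caterpillar obtained from a path with three vertices by attaching `a`, `b` and `c` pendant
vertices to its vertices. -/
def caterpillarThree (a b c : ℕ) : SimpleGraph (Fin 3 ⊕ (Fin a ⊕ (Fin b ⊕ Fin c))) :=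
  attachPendants (SimpleGraph.pathGraph 3)
    (Sum.elim (fun _ => 0) (Sum.elim (fun _ => 1) fun _ => 2))

theorem pendantCount_caterpillarThree (a b c : ℕ) (i : Fin 3) :
    pendantCount (Sum.elim (fun _ : Fin a => (0 : Fin 3))
      (Sum.elim (fun _ : Fin b => 1) fun _ : Fin c => 2)) i = ![a, b, c] i := by
  fin_cases i <;> simp [pendantCount_elim, pendantCount_const]

theorem pendantCount_doubleStar (p q : ℕ) (i : Fin 2) :
    pendantCount (Sum.elim (fun _ : Fin p => (0 : Fin 2)) (fun _ : Fin q => 1)) i = ![p, q] i := by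
  fin_cases i <;> simp [pendantCount_elim, pendantCount_const]

/-- The edge `v w` with a pendant vertex attached at an end `v` is a path with centre `v`; the new
vertex becomes the last vertex of the path. -/
def attachPendantsPathTwoIso [Unique ι] (v w : Fin 2) (h : w ≠ v) :
    attachPendants (SimpleGraph.pathGraph 2) (fun _ : ι => v) ≃g SimpleGraph.pathGraph 3 where
  toFun := Sum.elim (fun x => if x = v then 1 else 0) fun _ => 2
  invFun := ![Sum.inl w, Sum.inl v, Sum.inr default]
  left_inv := by
    rintro (x | i)
    · fin_cases v <;> fin_cases w <;> fin_cases x <;> simp_all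
    · simp [Unique.eq_default i]
  right_inv i := by fin_cases i <;> simp [h]
  map_rel_iff' := by
    rintro (x | i) (y | j)
    · fin_cases v <;> fin_cases w <;> fin_cases x <;> fin_cases y <;>
        simp_all [SimpleGraph.pathGraph_adj]
    · fin_cases v <;> fin_cases w <;> fin_cases x <;> simp_all [SimpleGraph.pathGraph_adj]
    · fin_cases v <;> fin_cases w <;> fin_cases y <;> simp_all [SimpleGraph.pathGraph_adj]
    · simp

theorem isTree_pathGraph_two : (SimpleGraph.pathGraph 2).IsTree :=
  ⟨SimpleGraph.pathGraph_connected 1, SimpleGraph.IsAcyclic.of_card_le_two (by simp)⟩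

theorem isTree_pathGraph_three : (SimpleGraph.pathGraph 3).IsTree :=
  (SimpleGraph.Iso.isTree_iff (attachPendantsPathTwoIso (ι := Unit) 0 1 (by decide))).1
    (isTree_attachPendants isTree_pathGraph_two _)

theorem nonempty_iso_caterpillarThree [Fintype ι] {C : SimpleGraph V} {f : ι → V}
    (e : C ≃g SimpleGraph.pathGraph 3) {a b c : ℕ}
    (h : ∀ v, pendantCount f v = ![a, b, c] (e v)) :
    Nonempty (attachPendants C f ≃g caterpillarThree a b c) :=
  nonempty_attachPendants_iso e fun v => by rw [pendantCount_caterpillarThree, h]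

theorem caterpillarThree_reverse (a b c : ℕ) :
    Nonempty (caterpillarThree a b c ≃g caterpillarThree c b a) := by
  refine nonempty_iso_caterpillarThree ⟨Fin.revPerm, fun {i j} => ?_⟩ fun i => ?_
  · fin_cases i <;> fin_cases j <;> simp [SimpleGraph.pathGraph_adj, Fin.rev]
  · rw [pendantCount_caterpillarThree]
    fin_cases i <;> rfl

theorem pathWithPendants_three_iso (n i : ℕ) :
    Nonempty (pathWithPendants n 3 i ≃g caterpillarThree i 0 (n - 3 - i)) := by
  refine nonempty_iso_caterpillarThree SimpleGraph.Iso.refl fun v => ?_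
  fin_cases v <;> simp [pendantCount_elim, pendantCount_const, Fin.rev]

theorem doubleStar'_iso (a b : ℕ) :
    Nonempty (doubleStar' a b ≃g caterpillarThree (a - 1) (b - 1) 1) := by
  obtain ⟨e⟩ := nonempty_iso_caterpillarThree (C := attachPendants (SimpleGraph.pathGraph 2) _)
    (f := Sum.elim (Sum.inl ∘ Sum.elim (fun _ : Fin (a - 1) => (0 : Fin 2))
      (fun _ : Fin (b - 1) => 1)) fun _ : Unit => Sum.inr ())
    (attachPendantsPathTwoIso (ι := Unit) 1 0 (by decide)) (a := a - 1) (b := b - 1) (c := 1) (by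
      rintro (v | v)
      · rw [pendantCount_elim, pendantCount_comp_injective _ Sum.inl_injective,
          pendantCount_doubleStar]
        fin_cases v <;> simp [pendantCount_const, attachPendantsPathTwoIso]
      · rw [pendantCount_elim, pendantCount_comp_of_notMem _ (by simp)]
        simp [pendantCount_const, attachPendantsPathTwoIso])
  exact ⟨(attachPendantsCommIso (SimpleGraph.pathGraph 2) _ _ _).trans e⟩

theorem doubleStar''_iso (a b : ℕ) :
    Nonempty (doubleStar'' a b ≃g caterpillarThree (b - 1) (a - 1) 1) := by
  obtain ⟨e⟩ := nonempty_iso_caterpillarThree (C := attachPendants (SimpleGraph.pathGraph 2) _)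
    (f := Sum.elim (Sum.inl ∘ Sum.elim (fun _ : Fin (a - 1) => (0 : Fin 2))
      (fun _ : Fin (b - 1) => 1)) fun _ : Unit => Sum.inr ())
    (attachPendantsPathTwoIso (ι := Unit) 0 1 (by decide)) (a := b - 1) (b := a - 1) (c := 1) (by
      rintro (v | v)
      · rw [pendantCount_elim, pendantCount_comp_injective _ Sum.inl_injective,
          pendantCount_doubleStar]
        fin_cases v <;> simp [pendantCount_const, attachPendantsPathTwoIso]
      · rw [pendantCount_elim, pendantCount_comp_of_notMem _ (by simp)]
        simp [pendantCount_const, attachPendantsPathTwoIso])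
  exact ⟨(attachPendantsCommIso (SimpleGraph.pathGraph 2) _ _ _).trans e⟩

theorem doubleStar_two_iso (q : ℕ) :
    Nonempty (doubleStar 2 q ≃g caterpillarThree 0 0 (q - 1)) := by
  let _ : Unique (Fin (2 - 1)) := inferInstanceAs (Unique (Fin 1))
  obtain ⟨e⟩ := nonempty_iso_caterpillarThree (C := attachPendants (SimpleGraph.pathGraph 2) _)
    (f := fun _ : Fin (q - 1) => Sum.inl (1 : Fin 2))
    (attachPendantsPathTwoIso (ι := Fin (2 - 1)) 0 1 (by decide)) (a := q - 1) (b := 0) (c := 0) (by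
      rintro (v | v)
      · fin_cases v <;> simp [pendantCount_const, attachPendantsPathTwoIso]
      · simp [pendantCount_const, attachPendantsPathTwoIso])
  obtain ⟨e'⟩ := caterpillarThree_reverse (q - 1) 0 0
  exact ⟨((attachPendantsElimIso (SimpleGraph.pathGraph 2) _ _).trans e).trans e'⟩

theorem lapPer_caterpillarThree (a b c : ℕ) : lapPer (caterpillarThree a b c) =
    (2 * a + 1) * (2 * b + 2) * (2 * c + 1) + (2 * a + 1) + (2 * c + 1) := by
  rw [caterpillarThree, lapPer_attachPendants _ _ ![true, false, true]
    (by simp [Fin.forall_fin_succ, SimpleGraph.pathGraph_adj])]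
  refine (corePermanent_pathGraph_three _).trans ?_
  simp [pendantCount_caterpillarThree]

theorem lapPer_doubleStar {p q : ℕ} (hp : 1 ≤ p) (hq : 1 ≤ q) :
    lapPer (doubleStar p q) = (2 * p - 1) * (2 * q - 1) + 1 := by
  rw [doubleStar, lapPer_attachPendants _ _ ![true, false]
    (by simp [Fin.forall_fin_succ, SimpleGraph.pathGraph_adj])]
  refine (corePermanent_pathGraph_two _).trans ?_
  simp [pendantCount_doubleStar, hp, hq]
  ring

theorem isBipartitionedTree_doubleStar {p q : ℕ} (hp : 1 ≤ p) (hq : 1 ≤ q) :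
    IsBipartitionedTree (doubleStar p q) p q := by
  have h := isBipartitionedTree_attachPendants isTree_pathGraph_two
    (Sum.elim (fun _ : Fin (p - 1) => (0 : Fin 2)) (fun _ : Fin (q - 1) => 1))
    ![false, true]
    (by simp [Fin.forall_fin_succ, SimpleGraph.pathGraph_adj])
  rw [doubleStar]
  convert h using 1
  · simp [classSize, pendantCount_doubleStar]
    omega
  · simp [classSize, pendantCount_doubleStar]
    omega

theorem isBipartitionedTree_caterpillarThree (a b c : ℕ) :
    IsBipartitionedTree (caterpillarThree a b c) (2 + b) (1 + a + c) := by
  have h := isBipartitionedTree_attachPendants isTree_pathGraph_three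
    (Sum.elim (fun _ : Fin a => (0 : Fin 3)) (Sum.elim (fun _ : Fin b => 1) fun _ : Fin c => 2))
    ![true, false, true]
    (by simp [Fin.forall_fin_succ, SimpleGraph.pathGraph_adj])
  rw [caterpillarThree]
  convert h using 1
  · simp [classSize, pendantCount_caterpillarThree, Fin.sum_univ_three]
    omega
  · simp [classSize, pendantCount_caterpillarThree, Fin.sum_univ_three]
    omega

theorem isBipartitionedTree_caterpillarThree' (a b c : ℕ) :
    IsBipartitionedTree (caterpillarThree a b c) (1 + a + c) (2 + b) := by
  obtain ⟨hT, V₁, V₂, h, hu, h1, h2⟩ := isBipartitionedTree_caterpillarThree a b c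
  exact ⟨hT, V₂, V₁, h.symm, by rw [Set.union_comm, hu], h2, h1⟩

end SmallCores

/-! ### Classification and extremal trees -/

section Classification

universe v

/-- A tree with class sizes `p, q ≥ 2` is a double star, or a caterpillar with three non-leaves,
or it has at least four non-leaves, and then its Laplacian permanent is large. -/
theorem IsBipartitionedTree.classification {V : Type v} [Fintype V] {T : SimpleGraph V} {p q : ℕ}
    (h : IsBipartitionedTree T p q) (hp : 2 ≤ p) (hq : 2 ≤ q) :
    Nonempty (T ≃g doubleStar p q) ∨
    (∃ a b c : ℕ, 1 ≤ a ∧ 1 ≤ c ∧ Nonempty (T ≃g caterpillarThree a b c) ∧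
      (p = 2 + b ∧ q = 1 + a + c ∨ p = 1 + a + c ∧ q = 2 + b)) ∨
    (3 ≤ p ∧ (2 * (p : ℤ) - 3) * (6 * q - 5) + 3 < lapPer T ∧
      (2 * (q : ℤ) - 3) * (6 * p - 5) + 3 < lapPer T) := by
  classical
  obtain ⟨W, _, C, ι, _, f, c, hcore, ⟨e⟩, h1, h2⟩ := h.exists_isCore (by omega)
  have hne : Nonempty W := hcore.isTree.connected.nonempty
  have hcard : 0 < Fintype.card W := Fintype.card_pos
  rcases (show Fintype.card W = 1 ∨ Fintype.card W = 2 ∨ Fintype.card W = 3 ∨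
    4 ≤ Fintype.card W by omega) with hW | hW | hW | hW
  · exfalso
    obtain ⟨w, hw⟩ := Fintype.card_eq_one_iff.1 hW
    have : Unique W := ⟨⟨w⟩, hw⟩
    simp only [classSize, Finset.univ_unique, Finset.sum_singleton] at h1 h2
    cases hc : c default <;> simp only [hc, if_true] at h1 h2 <;> omega
  · left
    obtain ⟨e'⟩ := nonempty_iso_pathGraph_two hcore.isTree hW
    have hne := (hcore.congr e').ne 0 1 (by simp [SimpleGraph.pathGraph_adj])
    have hsize : ∀ b, classSize (pendantCount f) c b =
        (if (c ∘ e') 0 = b then 1 else (pendantCount f ∘ e') 0) +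
        (if (c ∘ e') 1 = b then 1 else (pendantCount f ∘ e') 1) := fun b => by
      rw [← classSize_congr e'.toEquiv, classSize, Fin.sum_univ_two]
      rfl
    rw [hsize] at h1 h2
    have hiso : ∀ e₁ : SimpleGraph.pathGraph 2 ≃g C, 1 + pendantCount f (e₁ 0) = p →
        1 + pendantCount f (e₁ 1) = q → Nonempty (T ≃g doubleStar p q) := by
      intro e₁ h3 h4
      obtain ⟨e₂⟩ := nonempty_attachPendants_iso e₁ (g := f)
        (f := Sum.elim (fun _ : Fin (p - 1) => (0 : Fin 2)) (fun _ : Fin (q - 1) => 1))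
        (fun i => by
          rw [pendantCount_doubleStar]
          fin_cases i
          · simp only [Fin.zero_eta, Matrix.cons_val_zero]
            omega
          · simp only [Fin.mk_one, Matrix.cons_val_one]
            simp only [Matrix.cons_val_fin_one]
            omega)
      exact ⟨e.trans e₂.symm⟩
    cases hc0 : (c ∘ e') 0 <;> cases hc1 : (c ∘ e') 1
    · exact absurd (hc0.trans hc1.symm) hne
    · simp only [hc0, hc1, if_true, if_false, Bool.false_eq_true, reduceCtorEq] at h1 h2
      exact hiso e' (by rw [← h1, add_comm]; rfl) h2
    · simp only [hc0, hc1, if_true, if_false, Bool.false_eq_true, reduceCtorEq] at h1 h2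
      let e₀ : SimpleGraph.pathGraph 2 ≃g SimpleGraph.pathGraph 2 :=
        ⟨Equiv.swap 0 1, fun {i j} => by
          fin_cases i <;> fin_cases j <;> simp [SimpleGraph.pathGraph_adj]⟩
      exact hiso (e₀.trans e') h1 (by rw [← h2, add_comm]; rfl)
    · exact absurd (hc0.trans hc1.symm) hne
  · right; left
    obtain ⟨e'⟩ := nonempty_iso_pathGraph_three hcore.isTree hW c hcore.ne
    obtain ⟨hc1, hc2, hk0, hk2⟩ := (hcore.congr e').color_pathGraph_three
    have hsize : ∀ b, classSize (pendantCount f) c b =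
        (if (c ∘ e') 0 = b then 1 else (pendantCount f ∘ e') 0) +
        (if (c ∘ e') 1 = b then 1 else (pendantCount f ∘ e') 1) +
        (if (c ∘ e') 2 = b then 1 else (pendantCount f ∘ e') 2) := fun b => by
      rw [← classSize_congr e'.toEquiv, classSize, Fin.sum_univ_three]
      rfl
    obtain ⟨e₂⟩ := nonempty_iso_caterpillarThree (f := f) e'.symm
      (a := pendantCount f (e' 0)) (b := pendantCount f (e' 1)) (c := pendantCount f (e' 2))
      (fun v => by
        obtain ⟨i, rfl⟩ := e'.surjective v
        rw [RelIso.symm_apply_apply]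
        fin_cases i <;> rfl)
    refine ⟨pendantCount f (e' 0), pendantCount f (e' 1), pendantCount f (e' 2), hk0, hk2,
      ⟨e.trans e₂⟩, ?_⟩
    rw [hsize, hc1, hc2] at h1 h2
    simp only [Function.comp] at h1 h2
    cases hc0 : c (e' 0)
    · right
      simp [hc0] at h1 h2
      omega
    · left
      simp [hc0] at h1 h2
      omega
  · right; right
    have h3 := hcore.bound hW true
    have h4 := hcore.bound hW false
    have h5 := hcore.three_le_classSize hW true
    have h6 : lapPer T = corePermanent C (pendantCount f) :=
      (lapPer_congr e).trans (lapPer_attachPendants C f c hcore.ne)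
    simp only [Bool.not_true, Bool.not_false, h1, h2] at h3 h4 h5
    rw [h6]
    exact ⟨h5, h4, h3⟩

theorem lapPer_doubleStar' {p q : ℕ} (hp : 2 ≤ p) (hq : 2 ≤ q) :
    lapPer (doubleStar' (p - 1) (q - 1)) = (2 * (p : ℤ) - 3) * (6 * q - 5) + 3 := by
  obtain ⟨e⟩ : Nonempty (doubleStar' (p - 1) (q - 1) ≃g caterpillarThree (p - 2) (q - 2) 1) :=
    doubleStar'_iso (p - 1) (q - 1)
  rw [lapPer_congr e, lapPer_caterpillarThree]
  push_cast [hp, hq]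
  ring

theorem lapPer_doubleStar'' {p q : ℕ} (hp : 2 ≤ p) (hq : 2 ≤ q) :
    lapPer (doubleStar'' (p - 1) (q - 1)) = (2 * (q : ℤ) - 3) * (6 * p - 5) + 3 := by
  obtain ⟨e⟩ : Nonempty (doubleStar'' (p - 1) (q - 1) ≃g caterpillarThree (q - 2) (p - 2) 1) :=
    doubleStar''_iso (p - 1) (q - 1)
  rw [lapPer_congr e, lapPer_caterpillarThree]
  push_cast [hp, hq]
  ring

theorem lapPer_caterpillarThree_eq_add (a b c : ℕ) : lapPer (caterpillarThree a b c) =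
    (2 * ((1 + a + c : ℕ) : ℤ) - 3) * (6 * (2 + b : ℕ) - 5) + 3 +
      8 * ((b + 1) * ((a - 1) * (c - 1))) := by
  rw [lapPer_caterpillarThree]
  push_cast
  ring

theorem nonempty_caterpillarThree_iso {a b c : ℕ} (h : a = 1 ∨ c = 1) :
    Nonempty (caterpillarThree a b c ≃g caterpillarThree (1 + a + c - 2) (2 + b - 2) 1) := by
  rcases h with rfl | rfl
  · rw [show 1 + 1 + c - 2 = c by omega, Nat.add_sub_cancel_left]
    exact caterpillarThree_reverse 1 b c
  · rw [show 1 + a + 1 - 2 = a by omega, Nat.add_sub_cancel_left]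
    exact ⟨SimpleGraph.Iso.refl⟩

/-- Apart from the three extremal trees, all trees with class sizes `p ≤ q` have Laplacian
permanent larger than that of `D''(p-1,q-1)`. -/
theorem IsBipartitionedTree.iso_or_lt_lapPer {V : Type v} [Fintype V] {T : SimpleGraph V}
    {p q : ℕ} (h : IsBipartitionedTree T p q) (hp : 2 ≤ p) (hpq : p ≤ q) :
    Nonempty (T ≃g doubleStar p q) ∨ Nonempty (T ≃g doubleStar' (p - 1) (q - 1)) ∨
      Nonempty (T ≃g doubleStar'' (p - 1) (q - 1)) ∨
      (2 * (q : ℤ) - 3) * (6 * p - 5) + 3 < lapPer T := by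
  rcases h.classification hp (hp.trans hpq) with
    h | ⟨a, b, c, ha, hc, ⟨e⟩, hsize⟩ | ⟨-, -, h⟩
  · exact Or.inl h
  · by_cases hac : a = 1 ∨ c = 1
    · obtain ⟨e₁⟩ := nonempty_caterpillarThree_iso (b := b) hac
      rcases hsize with ⟨rfl, rfl⟩ | ⟨rfl, rfl⟩
      · obtain ⟨e₂⟩ := doubleStar''_iso (2 + b - 1) (1 + a + c - 1)
        exact Or.inr (Or.inr (Or.inl ⟨(e.trans e₁).trans e₂.symm⟩))
      · obtain ⟨e₂⟩ := doubleStar'_iso (1 + a + c - 1) (2 + b - 1)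
        exact Or.inr (Or.inl ⟨(e.trans e₁).trans e₂.symm⟩)
    · have h1 := lapPer_caterpillarThree_eq_add a b c
      have h2 : (1 : ℤ) ≤ ((a : ℤ) - 1) * (c - 1) :=
        one_le_mul_of_one_le_of_one_le (by omega) (by omega)
      have h3 : (b : ℤ) + 1 ≤ (b + 1) * ((a - 1) * (c - 1)) :=
        le_mul_of_one_le_right (by positivity) h2
      rw [lapPer_congr e]
      rcases hsize with ⟨hp', hq'⟩ | ⟨hp', hq'⟩
      · rw [← hp', ← hq'] at h1
        exact Or.inr (Or.inr (Or.inr (by linarith)))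
      · rw [← hp', ← hq'] at h1
        -- The values at `D''` and `D'` differ by `8 (q - p)`, which is less than `8 (b + 1)`.
        have h4 : (q : ℤ) - p < b + 1 := by omega
        exact Or.inr (Or.inr (Or.inr (by linarith)))
  · exact Or.inr (Or.inr (Or.inr h))

end Classification

theorem theorem3p3 :
    (∀ n : ℕ, 4 ≤ n →
      (∀ i : ℕ, i ≤ (n - 3) / 2 → IsBipartitionedTree (pathWithPendants n 3 i) 2 (n - 2)) ∧
      (∀ (V : Type u) [Fintype V] (T : SimpleGraph V), IsBipartitionedTree T 2 (n - 2) →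
        ∃ i : ℕ, i ≤ (n - 3) / 2 ∧ Nonempty (T ≃g pathWithPendants n 3 i)) ∧
      lapPer (doubleStar 2 (n - 2)) = lapPer (pathWithPendants n 3 0) ∧
      (∀ i j : ℕ, i < j → j ≤ (n - 3) / 2 →
        lapPer (pathWithPendants n 3 i) < lapPer (pathWithPendants n 3 j))) ∧
    (∀ p q : ℕ, 2 < p → p ≤ q →
      (IsBipartitionedTree (doubleStar p q) p q ∧
        IsBipartitionedTree (doubleStar' (p - 1) (q - 1)) p q ∧
        ¬ Nonempty (doubleStar' (p - 1) (q - 1) ≃g doubleStar p q) ∧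
        lapPer (doubleStar p q) < (2 * (p : ℤ) - 3) * (6 * q - 5) + 3 ∧
        ∀ (V : Type u) [Fintype V] (T : SimpleGraph V), IsBipartitionedTree T p q →
          ¬ Nonempty (T ≃g doubleStar p q) →
          (2 * (p : ℤ) - 3) * (6 * q - 5) + 3 ≤ lapPer T ∧
          (lapPer T = (2 * (p : ℤ) - 3) * (6 * q - 5) + 3 ↔
            Nonempty (T ≃g doubleStar' (p - 1) (q - 1)))) ∧
      (p < q →
        IsBipartitionedTree (doubleStar'' (p - 1) (q - 1)) p q ∧
        ¬ Nonempty (doubleStar'' (p - 1) (q - 1) ≃g doubleStar p q) ∧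
        ¬ Nonempty (doubleStar'' (p - 1) (q - 1) ≃g doubleStar' (p - 1) (q - 1)) ∧
        (2 * (p : ℤ) - 3) * (6 * q - 5) + 3 < (2 * (q : ℤ) - 3) * (6 * p - 5) + 3 ∧
        ∀ (V : Type u) [Fintype V] (T : SimpleGraph V), IsBipartitionedTree T p q →
          ¬ Nonempty (T ≃g doubleStar p q) →
          ¬ Nonempty (T ≃g doubleStar' (p - 1) (q - 1)) →
          (2 * (q : ℤ) - 3) * (6 * p - 5) + 3 ≤ lapPer T ∧
          (lapPer T = (2 * (q : ℤ) - 3) * (6 * p - 5) + 3 ↔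
            Nonempty (T ≃g doubleStar'' (p - 1) (q - 1))))) := by
  refine ⟨fun n hn => ⟨fun i hi => ?_, fun V _ T hT => ?_, ?_, fun i j hij hj => ?_⟩,
    fun p q hp hpq => ?_⟩
  · obtain ⟨e⟩ := pathWithPendants_three_iso n i
    refine IsBipartitionedTree.congr e ?_
    convert isBipartitionedTree_caterpillarThree i 0 (n - 3 - i) using 1
    omega
  · rcases hT.classification le_rfl (by omega) with ⟨⟨e⟩⟩ | ⟨a, b, c, ha, hc, ⟨e⟩, h⟩ | h
    · obtain ⟨e₁⟩ := doubleStar_two_iso (n - 2)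
      obtain ⟨e₂⟩ := pathWithPendants_three_iso n 0
      exact ⟨0, Nat.zero_le _, ⟨(e.trans e₁).trans e₂.symm⟩⟩
    · obtain ⟨rfl, hac⟩ : b = 0 ∧ n - 3 = a + c := by omega
      rcases le_total a c with hle | hle
      · obtain ⟨e₂⟩ := pathWithPendants_three_iso n a
        obtain rfl : n - 3 - a = c := by omega
        exact ⟨a, by omega, ⟨e.trans e₂.symm⟩⟩
      · obtain ⟨e₁⟩ := caterpillarThree_reverse a 0 c
        obtain ⟨e₂⟩ := pathWithPendants_three_iso n c
        obtain rfl : n - 3 - c = a := by omega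
        exact ⟨c, by omega, ⟨(e.trans e₁).trans e₂.symm⟩⟩
    · omega
  · obtain ⟨e₁⟩ := doubleStar_two_iso (n - 2)
    obtain ⟨e₂⟩ := pathWithPendants_three_iso n 0
    exact lapPer_congr (e₁.trans e₂.symm)
  · obtain ⟨e₁⟩ := pathWithPendants_three_iso n i
    obtain ⟨e₂⟩ := pathWithPendants_three_iso n j
    rw [lapPer_congr e₁, lapPer_congr e₂, lapPer_caterpillarThree, lapPer_caterpillarThree]
    -- With `s = n - 3`, the two permanents differ by `8 (j - i) (s - i - j)`.
    obtain ⟨d, rfl⟩ := Nat.exists_eq_add_of_lt hij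
    obtain ⟨m, hm⟩ := Nat.exists_eq_add_of_le (show 2 * (i + d + 1) ≤ n - 3 by omega)
    rw [show n - 3 - i = i + 2 * d + 2 + m by omega,
      show n - 3 - (i + d + 1) = i + d + 1 + m by omega]
    push_cast
    nlinarith [show (0 : ℤ) ≤ d * m by positivity, show (0 : ℤ) ≤ d * d by positivity]
  · have hp3 : (3 : ℤ) ≤ p := by exact_mod_cast hp
    have hpq' : (p : ℤ) ≤ q := by exact_mod_cast hpq
    obtain ⟨e'⟩ : Nonempty (doubleStar' (p - 1) (q - 1) ≃g caterpillarThree (p - 2) (q - 2) 1) :=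
      doubleStar'_iso (p - 1) (q - 1)
    obtain ⟨e''⟩ : Nonempty (doubleStar'' (p - 1) (q - 1) ≃g caterpillarThree (q - 2) (p - 2) 1) :=
      doubleStar''_iso (p - 1) (q - 1)
    have hD' := lapPer_doubleStar' (p := p) (q := q) (by omega) (by omega)
    have hD'' := lapPer_doubleStar'' (p := p) (q := q) (by omega) (by omega)
    -- The gap is `8 (p - 2) (q - 1)`.
    have hlt : lapPer (doubleStar p q) < (2 * (p : ℤ) - 3) * (6 * q - 5) + 3 := by
      rw [lapPer_doubleStar (by omega) (by omega)]
      nlinarith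
    -- The gap is `8 (q - p)`.
    have hle : (2 * (p : ℤ) - 3) * (6 * q - 5) + 3 ≤ (2 * (q : ℤ) - 3) * (6 * p - 5) + 3 := by
      linarith
    refine ⟨⟨isBipartitionedTree_doubleStar (by omega) (by omega), IsBipartitionedTree.congr e' ?_,
      fun ⟨e⟩ => ?_, hlt, fun V _ T hT hne => ?_⟩, fun hpq₁ => ?_⟩
    · convert isBipartitionedTree_caterpillarThree' (p - 2) (q - 2) 1 using 1 <;> omega
    · rw [← lapPer_congr e, hD'] at hlt
      exact lt_irrefl _ hlt
    · rcases hT.iso_or_lt_lapPer (by omega) hpq with h | ⟨⟨e⟩⟩ | ⟨⟨e⟩⟩ | h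
      · exact absurd h hne
      · have heq := (lapPer_congr e).trans hD'
        exact ⟨heq.ge, fun _ => ⟨e⟩, fun _ => heq⟩
      · have heq := (lapPer_congr e).trans hD''
        refine ⟨hle.trans heq.ge, fun h => ?_, fun ⟨e₁⟩ => (lapPer_congr e₁).trans hD'⟩
        -- Equality forces `p = q`, and then `D'' ≅ D'`.
        obtain rfl : p = q := by
          rw [heq] at h
          have : (p : ℤ) = q := by linarith
          exact_mod_cast this
        exact ⟨(e.trans e'').trans e'.symm⟩
      · have hlt' := hle.trans_lt h
        exact ⟨hlt'.le, fun heq => absurd heq hlt'.ne', fun ⟨e₁⟩ => (lapPer_congr e₁).trans hD'⟩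
    · have hpq₂ : (p : ℤ) + 1 ≤ q := by exact_mod_cast hpq₁
      have hlt' : (2 * (p : ℤ) - 3) * (6 * q - 5) + 3 < (2 * (q : ℤ) - 3) * (6 * p - 5) + 3 := by
        linarith
      refine ⟨IsBipartitionedTree.congr e'' ?_, fun ⟨e⟩ => ?_, fun ⟨e⟩ => ?_, hlt',
        fun V _ T hT hne hne' => ?_⟩
      · convert isBipartitionedTree_caterpillarThree (q - 2) (p - 2) 1 using 1 <;> omega
      · rw [← lapPer_congr e, hD''] at hlt
        exact lt_asymm hlt hlt'
      · rw [← hD', ← lapPer_congr e, hD''] at hlt'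
        exact lt_irrefl _ hlt'
      · rcases hT.iso_or_lt_lapPer (by omega) hpq with h | h | ⟨⟨e⟩⟩ | h
        · exact absurd h hne
        · exact absurd h hne'
        · have heq := (lapPer_congr e).trans hD''
          exact ⟨heq.ge, fun _ => ⟨e⟩, fun _ => heq⟩
        · exact ⟨h.le, fun heq => absurd heq h.ne', fun ⟨e₁⟩ => (lapPer_congr e₁).trans hD''⟩
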